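/- Let $V$ be a finite or countable set and $m:V\to(0,\infty)$; write $\ell^2(V,m)$ for the complex Hilbert space of functions $u:V\to\mathbb C$ with $\sum_x |u(x)|^2m(x)<\infty$, with inner product $\langle u,v\rangle=\sum_x u(x)\overline{v(x)}m(x)$. Let $(b,c)$ be a graph over $(V,m)$: $c:V\to[0,\infty)$, and $b:V\times V\to[0,\infty)$ is symmetric, vanishes on the diagonal and satisfies $\sum_y b(x,y)<\infty$ for every $x$. Assume that the graph is locally finite: $\{y: b(x,y)>0\}$ is finite for every $x$. The formal Laplacian is $$\widetilde L u(x)=\frac1{m(x)}\sum_{y}b(x,y)\,(u(x)-u(y))+\frac{c(x)}{m(x)}\,u(x),\qquad u\in\widetilde F=\Big\{u:V\to\mathbb C:\ \sum_y|b(x,y)u(y)|<\infty\ \text{for all } x\Big\}.$$ The form $Q^{(N)}$ is $$Q^{(N)}(u,v)=\frac12\sum_{x,y}b(x,y)(u(x)-u(y))\overline{(v(x)-v(y))}+\sum_x c(x)u(x)\overline{v(x)}$$ on the domain $D(Q^{(N)})$ of all $u\in\ell^2(V,m)$ with $\frac12\sum_{x,y} b(x,y)|u(x)-u(y)|^2+\sum_x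 c(x)|u(x)|^2<\infty$, and $Q^{(D)}$ is the closure (smallest closed extension) of the restriction of $Q^{(N)}$ to the finitely supported functions; here a non-negative symmetric form $Q$ is closed if $D(Q)$ is complete for the inner product $Q(u,v)+\langle u,v\rangle$. For non-negative forms, $Q_1\le Q_2$ means $D(Q_2)\subseteq D(Q_1)$ and $Q_1(u,u)\le Q_2(u,u)$ for all $u\in D(Q_2)$. The form associated to a non-negative self-adjoint operator $L$ is $Q(u,v)=\langle L^{1/2}u,L^{1/2}v\rangle$ on $D(Q)=D(L^{1/2})$. A Dirichlet form is a closed form $Q$ on $\ell^2(V,m)$ such that $Cu\in D(Q)$ and $Q(Cu,Cu)\le Q(u,u)$ for every $u\in D(Q)$ and every $C:\mathbb C\to\mathbb C$ with $C(0)=0$ and $|C(s)-C(t)|\le|s-t|$. A Markovian restriction of $\widetilde L$ is a non-negative self-adjoint operator on $\ell^2(V,m)$ that is a restriction of $\widetilde L$ and whose associated form is a Dirichlet form. Theorem. For every form $Q$ associated to a Markovian restriction $L$ of $\widetilde L$, $$Q^{(N)}\le Q\le Q^{(D)}.$$ Moreover, $Q^{(N)}$ and $Q^{(D)}$ are themselves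 the forms associated to Markovian restrictions of $\widetilde L$ (the Neumann Laplacian and the Dirichlet Laplacian). Thus, in the sense of forms, the Neumann Laplacian is the smallest and the Dirichlet Laplacian is the largest Markovian restriction of $\widetilde L$. -/

import Mathlib

open MeasureTheory Filter Topology
open scoped ComplexConjugate

/-- A (complex) sesquilinear form on a Hilbert space `H`, with domain a linear subspace;
linear in the first argument and conjugate linear in the second. -/
structure SesqForm (H : Type*) [NormedAddCommGroup H] [InnerProductSpace ℂ H] where
  domain : Submodule ℂ H
  toFun : domain →ₗ[ℂ] domain →ₗ⋆[ℂ] ℂ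

namespace SesqForm

variable {H : Type*} [NormedAddCommGroup H] [InnerProductSpace ℂ H]

/-- `Q(u,u) ≥ 0` (real and non-negative) for all `u` in the domain. -/
def IsNonneg (Q : SesqForm H) : Prop :=
  ∀ u : Q.domain, 0 ≤ (Q.toFun u u).re ∧ (Q.toFun u u).im = 0

def IsSymmetric (Q : SesqForm H) : Prop :=
  ∀ u v : Q.domain, Q.toFun u v = conj (Q.toFun v u)

/-- The square `Q(u,u) + ⟨u,u⟩` of the form norm. -/
noncomputable def normSq (Q : SesqForm H) (u : Q.domain) : ℝ :=
  (Q.toFun u u).re + ‖(u : H)‖ ^ 2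

/-- Closed forms: non-negative, symmetric, and the domain is complete for the form norm. -/
def IsClosed (Q : SesqForm H) : Prop :=
  Q.IsNonneg ∧ Q.IsSymmetric ∧
    ∀ u : ℕ → Q.domain,
      (∀ ε > 0, ∃ N, ∀ k ≥ N, ∀ l ≥ N, Q.normSq (u k - u l) < ε) →
      ∃ w : Q.domain, Tendsto (fun n => Q.normSq (u n - w)) atTop (𝓝 0)

/-- `Q₂` extends `Q₁`, written `Q₁ ⊆ Q₂`. -/
def IsExtendedBy (Q₁ Q₂ : SesqForm H) : Prop :=
  ∃ h : Q₁.domain ≤ Q₂.domain, ∀ u v : Q₁.domain,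
    Q₁.toFun u v = Q₂.toFun (Submodule.inclusion h u) (Submodule.inclusion h v)

/-- The order `Q₁ ≤ Q₂` of non-negative forms: `D(Q₂) ⊆ D(Q₁)` and `Q₁(u,u) ≤ Q₂(u,u)` for all
`u ∈ D(Q₂)`. -/
def FormLE (Q₁ Q₂ : SesqForm H) : Prop :=
  ∃ h : Q₂.domain ≤ Q₁.domain, ∀ u : Q₂.domain,
    (Q₁.toFun (Submodule.inclusion h u) (Submodule.inclusion h u)).re ≤ (Q₂.toFun u u).re

/-- The restriction of a form to a smaller domain. -/
def restrict (Q : SesqForm H) (D : Submodule ℂ H) (h : D ≤ Q.domain) : SesqForm H where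
  domain := D
  toFun := LinearMap.mk₂'ₛₗ (RingHom.id ℂ) (starRingEnd ℂ)
    (fun u v => Q.toFun (Submodule.inclusion h u) (Submodule.inclusion h v))
    (by intros; simp) (by intros; simp) (by intros; simp) (by intros; simp)

/-- `Q'` is the closure of `Q`, i.e. the smallest closed extension of `Q`. -/
def IsClosureOf (Q' Q : SesqForm H) : Prop :=
  Q'.IsClosed ∧ Q.IsExtendedBy Q' ∧
    ∀ Q'' : SesqForm H, Q''.IsClosed → Q.IsExtendedBy Q'' → Q'.IsExtendedBy Q''

theorem normSq_nonneg {Q : SesqForm H} (hQ : Q.IsNonneg) (u : Q.domain) : 0 ≤ Q.normSq u :=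
  add_nonneg (hQ u).1 (sq_nonneg _)

theorem normSq_smul (Q : SesqForm H) (a : ℂ) (u : Q.domain) :
    Q.normSq (a • u) = ‖a‖ ^ 2 * Q.normSq u := by
  have h : Q.toFun (a • u) (a • u) = ((‖a‖ ^ 2 : ℝ) : ℂ) * Q.toFun u u := by
    simp only [map_smul, LinearMap.smul_apply, LinearMap.map_smulₛₗ, smul_eq_mul]
    rw [← mul_assoc, mul_comm (conj a), Complex.mul_conj, Complex.normSq_eq_norm_sq]
  simp only [normSq, h, Complex.re_ofReal_mul, Submodule.coe_smul, norm_smul]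
  ring

theorem normSq_add_le {Q : SesqForm H} (hQ : Q.IsNonneg) (u v : Q.domain) :
    Q.normSq (u + v) ≤ 2 * Q.normSq u + 2 * Q.normSq v := by
  have h1 := normSq_nonneg hQ (u - v)
  have h2 := parallelogram_law_with_norm ℂ (u : H) (v : H)
  simp only [normSq, map_add, map_sub, LinearMap.add_apply, LinearMap.sub_apply, Complex.add_re,
    Complex.sub_re, Submodule.coe_add, Submodule.coe_sub] at h1 ⊢
  nlinarith

/-- The closure of a set `D ⊆ D(Q)` in `D(Q)` with respect to the form norm of a non-negative form
`Q`. -/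
def formClosure (Q : SesqForm H) (hQ : Q.IsNonneg) (D : Submodule ℂ H) : Submodule ℂ H where
  carrier := {u | ∃ hu : u ∈ Q.domain, ∀ ε > 0, ∃ v : Q.domain, (v : H) ∈ D ∧
    Q.normSq (⟨u, hu⟩ - v) < ε}
  zero_mem' := ⟨Q.domain.zero_mem, fun ε hε => ⟨0, D.zero_mem, by
    have : (⟨0, Q.domain.zero_mem⟩ : Q.domain) = 0 := rfl
    simpa [this, normSq] using hε⟩⟩
  add_mem' := by
    rintro a b ⟨ha, ha'⟩ ⟨hb, hb'⟩
    refine ⟨Q.domain.add_mem ha hb, fun ε hε => ?_⟩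
    obtain ⟨v, hv, hv'⟩ := ha' (ε / 4) (by positivity)
    obtain ⟨w, hw, hw'⟩ := hb' (ε / 4) (by positivity)
    refine ⟨v + w, D.add_mem hv hw, ?_⟩
    have e : (⟨a + b, Q.domain.add_mem ha hb⟩ : Q.domain) - (v + w) =
        (⟨a, ha⟩ - v) + (⟨b, hb⟩ - w) := by
      ext; simp; abel
    rw [e]
    have := normSq_add_le hQ (⟨a, ha⟩ - v) (⟨b, hb⟩ - w)
    linarith
  smul_mem' := by
    rintro a u ⟨hu, hu'⟩
    refine ⟨Q.domain.smul_mem a hu, fun ε hε => ?_⟩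
    have hp : 0 < ‖a‖ ^ 2 + 1 := by positivity
    obtain ⟨v, hv, hv'⟩ := hu' (ε / (‖a‖ ^ 2 + 1)) (by positivity)
    refine ⟨a • v, D.smul_mem a hv, ?_⟩
    have e : (⟨a • u, Q.domain.smul_mem a hu⟩ : Q.domain) - a • v = a • (⟨u, hu⟩ - v) := by
      ext; simp [smul_sub]
    rw [e, normSq_smul]
    have h0 := normSq_nonneg hQ (⟨u, hu⟩ - v)
    rw [lt_div_iff₀ hp] at hv'
    nlinarith

theorem formClosure_le (Q : SesqForm H) (hQ : Q.IsNonneg) (D : Submodule ℂ H) :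
    Q.formClosure hQ D ≤ Q.domain := fun _ h => h.1

/-- Non-negativity of an operator: `⟨Lu,u⟩ ≥ 0` for all `u` in the domain (for self-adjoint `L`
these numbers are real). -/
def _root_.LinearPMap.IsNonneg (L : H →ₗ.[ℂ] H) : Prop :=
  ∀ u : L.domain, 0 ≤ (inner ℂ (u : H) (L u)).re

/-- `S = L^{1/2}`: `S` is self-adjoint, non-negative and `S ∘ S = L`, with equality of domains. -/
def _root_.LinearPMap.IsSqrtOf [CompleteSpace H] (S L : H →ₗ.[ℂ] H) : Prop :=
  IsSelfAdjoint S ∧ S.IsNonneg ∧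
    ∀ u w : H, (u, w) ∈ L.graph ↔ ∃ z : H, (u, z) ∈ S.graph ∧ (z, w) ∈ S.graph

/-- `Q` is the form associated to the non-negative self-adjoint operator `L`:
`D(Q) = D(L^{1/2})` and `Q(u,v) = ⟨L^{1/2} u, L^{1/2} v⟩`
(Mathlib's `inner` is conjugate linear in the first argument). -/
def IsAssociatedTo [CompleteSpace H] (Q : SesqForm H) (L : H →ₗ.[ℂ] H) : Prop :=
  ∃ S : H →ₗ.[ℂ] H, S.IsSqrtOf L ∧ ∃ h : Q.domain = S.domain, ∀ u v : Q.domain,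
    Q.toFun u v = inner ℂ (S ⟨v, h ▸ v.2⟩) (S ⟨u, h ▸ u.2⟩)

/-- Dirichlet forms on a space of square integrable functions: closed forms such that
`Cu ∈ D(Q)` and `Q(Cu,Cu) ≤ Q(u,u)` for all `u ∈ D(Q)` and all normal contractions `C : ℂ → ℂ`. -/
def IsDirichletForm {X : Type*} [MeasurableSpace X] {μ : Measure X}
    (Q : SesqForm (Lp ℂ 2 μ)) : Prop :=
  Q.IsClosed ∧ ∀ (C : ℂ → ℂ) (hC : LipschitzWith 1 C) (h0 : C 0 = 0) (u : Q.domain),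
    ∃ h : hC.compLp h0 (u : Lp ℂ 2 μ) ∈ Q.domain,
      (Q.toFun ⟨_, h⟩ ⟨_, h⟩).re ≤ (Q.toFun u u).re

end SesqForm

/-- A symmetric weighted graph `(b, c)` over the discrete measure space `(V, m)`. -/
structure WeightedGraph (V : Type*) where
  m : V → ℝ
  b : V → V → ℝ
  c : V → ℝ
  m_pos : ∀ x, 0 < m x
  b_nonneg : ∀ x y, 0 ≤ b x y
  c_nonneg : ∀ x, 0 ≤ c x
  b_self : ∀ x, b x x = 0
  b_symm : ∀ x y, b x y = b y x
  b_summable : ∀ x, Summable (b x)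

namespace WeightedGraph

set_option linter.unusedSectionVars false

variable {V : Type*}

/-- Every vertex has only finitely many neighbors. -/
def LocallyFinite (G : WeightedGraph V) : Prop := ∀ x, {y | 0 < G.b x y}.Finite

/-- The domain `F̃` of the formal Laplacian. -/
def formalDomain (G : WeightedGraph V) : Set (V → ℂ) :=
  {u | ∀ x, Summable fun y => ‖(G.b x y : ℂ) * u y‖}

/-- The formal Laplacian `L̃` (meaningful on `F̃`). -/
noncomputable def formalLaplacian (G : WeightedGraph V) (u : V → ℂ) (x : V) : ℂ :=
  1 / (G.m x : ℂ) * ∑' y, (G.b x y : ℂ) * (u x - u y) + (G.c x : ℂ) / (G.m x : ℂ) * u x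

variable [MeasurableSpace V]

/-- The measure on `V` with `μ {x} = m x`. -/
noncomputable def measure (G : WeightedGraph V) : Measure V :=
  Measure.sum fun x => ENNReal.ofReal (G.m x) • Measure.dirac x

/-- The Hilbert space `ℓ²(V, m)`. Every point of `V` has positive mass, so that an element `u` of
this space has well-defined values `u x`. -/
abbrev ell2 (G : WeightedGraph V) : Type _ := Lp ℂ 2 G.measure

variable [DiscreteMeasurableSpace V]

theorem forall_of_ae (G : WeightedGraph V) {p : V → Prop} (h : ∀ᵐ x ∂G.measure, p x) (x : V) :
    p x := by
  rw [measure, Measure.ae_sum_iff' (MeasurableSet.of_discrete)] at h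
  have := h x
  rw [Measure.ae_ennreal_smul_measure_iff (by simpa using G.m_pos x)] at this
  simpa [ae_dirac_eq] using this

theorem coe_add (G : WeightedGraph V) (u v : G.ell2) (x : V) : (u + v) x = u x + v x :=
  G.forall_of_ae (Lp.coeFn_add u v) x

theorem coe_sub (G : WeightedGraph V) (u v : G.ell2) (x : V) : (u - v) x = u x - v x :=
  G.forall_of_ae (Lp.coeFn_sub u v) x

theorem coe_smul (G : WeightedGraph V) (a : ℂ) (u : G.ell2) (x : V) : (a • u) x = a * u x :=
  G.forall_of_ae (Lp.coeFn_smul a u) x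

theorem coe_zero (G : WeightedGraph V) (x : V) : (0 : G.ell2) x = 0 :=
  G.forall_of_ae (Lp.coeFn_zero ℂ 2 G.measure) x

/-- The difference `u(x) - u(y)` along the pair `p = (x, y)`. -/
noncomputable def diff (G : WeightedGraph V) (u : G.ell2) (p : V × V) : ℂ := u p.1 - u p.2

theorem diff_add (G : WeightedGraph V) (u v : G.ell2) (p : V × V) :
    G.diff (u + v) p = G.diff u p + G.diff v p := by
  simp only [diff, coe_add]; ring

theorem diff_sub (G : WeightedGraph V) (u v : G.ell2) (p : V × V) :
    G.diff (u - v) p = G.diff u p - G.diff v p := by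
  simp only [diff, coe_sub]; ring

theorem diff_smul (G : WeightedGraph V) (a : ℂ) (u : G.ell2) (p : V × V) :
    G.diff (a • u) p = a * G.diff u p := by
  simp only [diff, coe_smul]; ring

theorem summable_weight_add {ι : Type*} {w : ι → ℝ} (hw : ∀ i, 0 ≤ w i) {f g : ι → ℂ}
    (hf : Summable fun i => w i * ‖f i‖ ^ 2) (hg : Summable fun i => w i * ‖g i‖ ^ 2) :
    Summable fun i => w i * ‖f i + g i‖ ^ 2 := by
  refine Summable.of_nonneg_of_le (fun i => mul_nonneg (hw i) (sq_nonneg _)) (fun i => ?_)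
    ((hf.mul_left 2).add (hg.mul_left 2))
  have h1 := norm_add_le (f i) (g i)
  have h2 : ‖f i + g i‖ ^ 2 ≤ 2 * ‖f i‖ ^ 2 + 2 * ‖g i‖ ^ 2 := by
    nlinarith [sq_nonneg (‖f i‖ - ‖g i‖), norm_nonneg (f i + g i)]
  nlinarith [mul_le_mul_of_nonneg_left h2 (hw i)]

theorem summable_weight_smul {ι : Type*} {w : ι → ℝ} (a : ℂ) {f : ι → ℂ}
    (hf : Summable fun i => w i * ‖f i‖ ^ 2) : Summable fun i => w i * ‖a * f i‖ ^ 2 := by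
  refine (hf.mul_left (‖a‖ ^ 2)).congr fun i => ?_
  rw [norm_mul]; ring

theorem summable_weight_mul {ι : Type*} {w : ι → ℝ} (hw : ∀ i, 0 ≤ w i) {f g : ι → ℂ}
    (hf : Summable fun i => w i * ‖f i‖ ^ 2) (hg : Summable fun i => w i * ‖g i‖ ^ 2) :
    Summable fun i => (w i : ℂ) * f i * conj (g i) := by
  refine Summable.of_norm_bounded (hf.add hg) fun i => ?_
  rw [norm_mul, norm_mul, Complex.norm_real, RCLike.norm_conj, Real.norm_of_nonneg (hw i)]
  have h2 : ‖f i‖ * ‖g i‖ ≤ ‖f i‖ ^ 2 + ‖g i‖ ^ 2 := by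
    nlinarith [sq_nonneg (‖f i‖ - ‖g i‖), sq_nonneg (‖f i‖), sq_nonneg (‖g i‖)]
  nlinarith [mul_le_mul_of_nonneg_left h2 (hw i)]

/-- Finiteness of the energy `1/2 ∑ b(x,y) |u(x) - u(y)|² + ∑ c(x) |u(x)|²` (both sums are sums of
non-negative terms). -/
def HasFiniteEnergy (G : WeightedGraph V) (u : G.ell2) : Prop :=
  (Summable fun p : V × V => G.b p.1 p.2 * ‖G.diff u p‖ ^ 2) ∧
    Summable fun x => G.c x * ‖u x‖ ^ 2

theorem HasFiniteEnergy.zero (G : WeightedGraph V) : G.HasFiniteEnergy 0 := by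
  refine ⟨summable_zero.congr fun p => ?_, summable_zero.congr fun x => ?_⟩
  · rw [diff, coe_zero, coe_zero]; simp
  · rw [coe_zero]; simp

theorem HasFiniteEnergy.add {G : WeightedGraph V} {u v : G.ell2} (hu : G.HasFiniteEnergy u)
    (hv : G.HasFiniteEnergy v) : G.HasFiniteEnergy (u + v) := by
  have h1 := summable_weight_add (w := fun p : V × V => G.b p.1 p.2) (f := G.diff u)
    (g := G.diff v) (fun p => G.b_nonneg p.1 p.2) hu.1 hv.1
  have h2 := summable_weight_add (w := G.c) (f := fun x => u x) (g := fun x => v x)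
    G.c_nonneg hu.2 hv.2
  refine ⟨h1.congr fun p => ?_, h2.congr fun x => ?_⟩
  · rw [diff_add]
  · rw [coe_add]

theorem HasFiniteEnergy.smul {G : WeightedGraph V} (a : ℂ) {u : G.ell2}
    (hu : G.HasFiniteEnergy u) : G.HasFiniteEnergy (a • u) := by
  have h1 := summable_weight_smul (w := fun p : V × V => G.b p.1 p.2) (f := G.diff u) a hu.1
  have h2 := summable_weight_smul (w := G.c) (f := fun x => u x) a hu.2
  refine ⟨h1.congr fun p => ?_, h2.congr fun x => ?_⟩
  · rw [diff_smul]
  · rw [coe_smul]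

theorem HasFiniteEnergy.summable_b {G : WeightedGraph V} {u v : G.ell2} (hu : G.HasFiniteEnergy u)
    (hv : G.HasFiniteEnergy v) :
    Summable fun p : V × V => (G.b p.1 p.2 : ℂ) * G.diff u p * conj (G.diff v p) :=
  summable_weight_mul (w := fun p : V × V => G.b p.1 p.2) (f := G.diff u) (g := G.diff v)
    (fun p => G.b_nonneg p.1 p.2) hu.1 hv.1

theorem HasFiniteEnergy.summable_c {G : WeightedGraph V} {u v : G.ell2} (hu : G.HasFiniteEnergy u)
    (hv : G.HasFiniteEnergy v) : Summable fun x => (G.c x : ℂ) * u x * conj (v x) :=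
  summable_weight_mul (w := G.c) (f := fun x => u x) (g := fun x => v x) G.c_nonneg hu.2 hv.2

/-- `Q̃(u,v) = 1/2 ∑ b(x,y) (u(x) - u(y)) conj (v(x) - v(y)) + ∑ c(x) u(x) conj (v(x))`, where both
sums converge absolutely for `u`, `v` of finite energy. -/
noncomputable def energy (G : WeightedGraph V) (u v : G.ell2) : ℂ :=
  1 / 2 * ∑' p : V × V, (G.b p.1 p.2 : ℂ) * G.diff u p * conj (G.diff v p) +
    ∑' x, (G.c x : ℂ) * u x * conj (v x)

theorem energy_conj_symm (G : WeightedGraph V) (u v : G.ell2) :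
    conj (G.energy u v) = G.energy v u := by
  simp only [energy, map_add, map_mul, Complex.conj_tsum, Complex.conj_ofReal, Complex.conj_conj,
    map_div₀, map_one, map_ofNat]
  congr 2
  · exact tsum_congr fun p => by ring
  · funext x; ring

theorem energy_add_left {G : WeightedGraph V} {u₁ u₂ v : G.ell2} (h₁ : G.HasFiniteEnergy u₁)
    (h₂ : G.HasFiniteEnergy u₂) (hv : G.HasFiniteEnergy v) :
    G.energy (u₁ + u₂) v = G.energy u₁ v + G.energy u₂ v := by
  simp only [energy, diff_add, coe_add, mul_add, add_mul]
  rw [(h₁.summable_b hv).tsum_add (h₂.summable_b hv),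
    (h₁.summable_c hv).tsum_add (h₂.summable_c hv)]
  ring

theorem energy_smul_left (G : WeightedGraph V) (a : ℂ) (u v : G.ell2) :
    G.energy (a • u) v = a * G.energy u v := by
  simp only [energy, diff_smul, coe_smul, mul_add]
  rw [mul_left_comm a, ← tsum_mul_left (a := a), ← tsum_mul_left (a := a)]
  congr 2
  · exact tsum_congr fun p => by ring
  · funext x; ring

theorem energy_add_right {G : WeightedGraph V} {u v₁ v₂ : G.ell2} (hu : G.HasFiniteEnergy u)
    (h₁ : G.HasFiniteEnergy v₁) (h₂ : G.HasFiniteEnergy v₂) :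
    G.energy u (v₁ + v₂) = G.energy u v₁ + G.energy u v₂ := by
  rw [← energy_conj_symm, energy_add_left h₁ h₂ hu, map_add, energy_conj_symm, energy_conj_symm]

theorem energy_smul_right (G : WeightedGraph V) (a : ℂ) (u v : G.ell2) :
    G.energy u (a • v) = conj a * G.energy u v := by
  rw [← energy_conj_symm, energy_smul_left, map_mul, energy_conj_symm]

theorem energy_self (G : WeightedGraph V) (u : G.ell2) :
    G.energy u u = ((1 / 2 * ∑' p : V × V, G.b p.1 p.2 * ‖G.diff u p‖ ^ 2 +
        ∑' x, G.c x * ‖u x‖ ^ 2 : ℝ) : ℂ) := by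
  simp only [energy, mul_assoc, Complex.mul_conj, Complex.normSq_eq_norm_sq]
  push_cast
  rfl

/-- The domain of the Neumann form: all `u ∈ ℓ²(V,m)` of finite energy. -/
def neumannDomain (G : WeightedGraph V) : Submodule ℂ G.ell2 where
  carrier := {u | G.HasFiniteEnergy u}
  zero_mem' := HasFiniteEnergy.zero G
  add_mem' := fun hu hv => HasFiniteEnergy.add hu hv
  smul_mem' := fun a _ hu => HasFiniteEnergy.smul a hu

/-- The Neumann form `Q^(N)`. -/
noncomputable def neumannForm (G : WeightedGraph V) : SesqForm G.ell2 where
  domain := G.neumannDomain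
  toFun := LinearMap.mk₂'ₛₗ (RingHom.id ℂ) (starRingEnd ℂ)
    (fun u v => G.energy u v)
    (fun u₁ u₂ v => energy_add_left u₁.2 u₂.2 v.2)
    (fun a u v => G.energy_smul_left a u v)
    (fun u v₁ v₂ => energy_add_right u.2 v₁.2 v₂.2)
    (fun a u v => G.energy_smul_right a u v)

theorem neumannForm_isNonneg (G : WeightedGraph V) : G.neumannForm.IsNonneg := by
  intro u
  change 0 ≤ (G.energy u u).re ∧ (G.energy u u).im = 0
  rw [energy_self, Complex.ofReal_re, Complex.ofReal_im]
  refine ⟨add_nonneg (mul_nonneg (by norm_num) (tsum_nonneg fun p => ?_))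
    (tsum_nonneg fun x => ?_), rfl⟩
  · exact mul_nonneg (G.b_nonneg _ _) (sq_nonneg _)
  · exact mul_nonneg (G.c_nonneg _) (sq_nonneg _)

/-- The space `C_c(V)` of finitely supported functions, as a subspace of `ℓ²(V,m)`. -/
def finSupp (G : WeightedGraph V) : Submodule ℂ G.ell2 where
  carrier := {u | (Function.support (u : V → ℂ)).Finite}
  zero_mem' := by
    have h : (⇑(0 : G.ell2) : V → ℂ) = 0 := funext G.coe_zero
    change (Function.support (⇑(0 : G.ell2) : V → ℂ)).Finite
    rw [h]; simp
  add_mem' := by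
    intro u v hu hv
    refine (hu.union hv).subset fun x hx => ?_
    by_contra h
    simp only [Set.mem_union, Function.mem_support, not_or, not_not] at h
    exact hx (by rw [coe_add, h.1, h.2, add_zero])
  smul_mem' := by
    intro a u hu
    refine hu.subset fun x hx => ?_
    intro h
    exact hx (by rw [coe_smul, h, mul_zero])

theorem summable_of_finite_support_aux (G : WeightedGraph V) {f : V → ℂ}
    (hf : (Function.support f).Finite) :
    Summable fun p : V × V => G.b p.1 p.2 * ‖f p.1 - f p.2‖ ^ 2 := by
  have hw : ∀ p : V × V, 0 ≤ G.b p.1 p.2 := fun p => G.b_nonneg _ _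
  have key : Summable fun p : V × V => G.b p.1 p.2 * ‖f p.1‖ ^ 2 := by
    have h1 : ∀ x, Summable fun y => G.b x y * ‖f x‖ ^ 2 := fun x =>
      (G.b_summable x).mul_right (‖f x‖ ^ 2)
    have h2 : Summable fun x => ∑' y, G.b x y * ‖f x‖ ^ 2 := by
      refine summable_of_hasFiniteSupport (hf.subset fun x hx h => hx ?_)
      simp [h]
    have h0 : 0 ≤ fun p : V × V => G.b p.1 p.2 * ‖f p.1‖ ^ 2 :=
      fun p => mul_nonneg (hw p) (sq_nonneg _)
    exact (summable_prod_of_nonneg h0).mpr ⟨h1, h2⟩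
  have key2 : Summable fun p : V × V => G.b p.1 p.2 * ‖-f p.2‖ ^ 2 := by
    have := (Equiv.prodComm V V).summable_iff.mpr key
    refine this.congr fun p => ?_
    simp [G.b_symm p.1 p.2]
  exact (summable_weight_add (w := fun p : V × V => G.b p.1 p.2) (f := fun p => f p.1)
    (g := fun p => -f p.2) hw key key2).congr fun p => by rw [sub_eq_add_neg]

theorem finSupp_le (G : WeightedGraph V) : G.finSupp ≤ G.neumannForm.domain := by
  intro u hu
  change (Function.support (fun x => u x)).Finite at hu
  change G.HasFiniteEnergy u
  refine ⟨G.summable_of_finite_support_aux hu,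
    summable_of_hasFiniteSupport (hu.subset fun x hx h => hx ?_)⟩
  have h' : u x = 0 := h
  simp [h']

/-- The restriction `Q^comp` of `Q^(N)` to `C_c(V)`. -/
noncomputable def compForm (G : WeightedGraph V) : SesqForm G.ell2 :=
  G.neumannForm.restrict G.finSupp G.finSupp_le

/-- The Dirichlet form `Q^(D)`: the restriction of `Q^(N)` to the closure of `C_c(V)` with respect
to the form norm. By `dirichletForm_isClosureOf` below it is the closure of `Q^comp`, that is,
the smallest closed extension of `Q^comp`. -/
noncomputable def dirichletForm (G : WeightedGraph V) : SesqForm G.ell2 :=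
  G.neumannForm.restrict (G.neumannForm.formClosure G.neumannForm_isNonneg G.finSupp)
    (G.neumannForm.formClosure_le _ _)

/-- `L` is a restriction of the formal Laplacian: `D(L) ⊆ F̃` and `Lu = L̃u` for `u ∈ D(L)`. -/
def IsRestrictionOfFormal (G : WeightedGraph V) (L : G.ell2 →ₗ.[ℂ] G.ell2) : Prop :=
  ∀ u : L.domain, ((u : G.ell2) : V → ℂ) ∈ G.formalDomain ∧
    ∀ x, (L u) x = G.formalLaplacian (u : G.ell2) x

/-- Markovian restrictions of the formal Laplacian: non-negative self-adjoint restrictions whose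
associated form is a Dirichlet form. -/
def IsMarkovianRestriction (G : WeightedGraph V) (L : G.ell2 →ₗ.[ℂ] G.ell2) : Prop :=
  IsSelfAdjoint L ∧ L.IsNonneg ∧ G.IsRestrictionOfFormal L ∧
    ∃ Q : SesqForm G.ell2, Q.IsAssociatedTo L ∧ Q.IsDirichletForm

end WeightedGraph

namespace SesqForm

variable {H : Type*} [NormedAddCommGroup H] [InnerProductSpace ℂ H]

theorem normSq_sub_comm (Q : SesqForm H) (u v : Q.domain) :
    Q.normSq (u - v) = Q.normSq (v - u) := by
  have := normSq_smul Q (-1) (v - u)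
  rw [← neg_sub v u, ← neg_one_smul ℂ (v - u), this]
  simp

theorem normSq_sub_le {Q : SesqForm H} (hQ : Q.IsNonneg) (u v w : Q.domain) :
    Q.normSq (u - w) ≤ 2 * Q.normSq (u - v) + 2 * Q.normSq (v - w) := by
  rw [← sub_add_sub_cancel u v w]
  exact normSq_add_le hQ _ _

theorem norm_sq_le (Q : SesqForm H) (h0 : Q.IsNonneg) (hs : Q.IsSymmetric) (u v : Q.domain) :
    ‖Q.toFun u v‖ ^ 2 ≤ Q.normSq u * Q.normSq v := by
  let c : PreInnerProductSpace.Core ℂ Q.domain :=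
    { inner := fun x y => Q.toFun y x
      conj_inner_symm := fun x y => (hs y x).symm
      re_inner_nonneg := fun x => (h0 x).1
      add_left := fun x y z => by simp
      smul_left := fun x y r => by simp }
  have h := @InnerProductSpace.Core.inner_mul_inner_self_le ℂ Q.domain _ _ _ c u v
  have h1 : ‖Q.toFun v u‖ * ‖Q.toFun u v‖ ≤ (Q.toFun u u).re * (Q.toFun v v).re := h
  have h2 : ‖Q.toFun v u‖ = ‖Q.toFun u v‖ := by rw [hs v u, RCLike.norm_conj]
  rw [h2, ← sq] at h1
  refine h1.trans (mul_le_mul ?_ ?_ (h0 v).1 (normSq_nonneg h0 u))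
  · exact le_add_of_nonneg_right (sq_nonneg _)
  · exact le_add_of_nonneg_right (sq_nonneg _)

theorem tendsto_left (Q : SesqForm H) (h0 : Q.IsNonneg) (hs : Q.IsSymmetric)
    {u : ℕ → Q.domain} {w : Q.domain} (hu : Tendsto (fun n => Q.normSq (u n - w)) atTop (𝓝 0))
    (v : Q.domain) : Tendsto (fun n => Q.toFun (u n) v) atTop (𝓝 (Q.toFun w v)) := by
  rw [tendsto_iff_norm_sub_tendsto_zero]
  have h1 : Tendsto (fun n => √(Q.normSq (u n - w) * Q.normSq v)) atTop (𝓝 0) := by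
    have := (hu.mul_const (Q.normSq v)).sqrt
    simpa using this
  refine squeeze_zero (fun n => norm_nonneg _) (fun n => ?_) h1
  rw [← LinearMap.sub_apply, ← map_sub]
  exact Real.le_sqrt_of_sq_le (Q.norm_sq_le h0 hs _ _)

theorem tendsto_right (Q : SesqForm H) (h0 : Q.IsNonneg) (hs : Q.IsSymmetric)
    {u : ℕ → Q.domain} {w : Q.domain} (hu : Tendsto (fun n => Q.normSq (u n - w)) atTop (𝓝 0))
    (v : Q.domain) : Tendsto (fun n => Q.toFun v (u n)) atTop (𝓝 (Q.toFun v w)) := by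
  rw [hs v w]
  simp_rw [hs v]
  exact (Complex.continuous_conj.tendsto _).comp (Q.tendsto_left h0 hs hu v)

theorem tendsto_coe (Q : SesqForm H) (h0 : Q.IsNonneg)
    {u : ℕ → Q.domain} {w : Q.domain} (hu : Tendsto (fun n => Q.normSq (u n - w)) atTop (𝓝 0)) :
    Tendsto (fun n => (u n : H)) atTop (𝓝 (w : H)) := by
  rw [tendsto_iff_norm_sub_tendsto_zero]
  have h1 : Tendsto (fun n => √(Q.normSq (u n - w))) atTop (𝓝 0) := by simpa using hu.sqrt
  refine squeeze_zero (fun n => norm_nonneg _) (fun n => ?_) h1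
  exact Real.le_sqrt_of_sq_le (le_add_of_nonneg_left (h0 _).1)

/-- If `Q` is closed and `D ⊆ D(Q)`, then the restriction of `Q` to the form norm closure of `D`
is the closure of the restriction of `Q` to `D`. -/
theorem restrict_formClosure_isClosureOf (Q : SesqForm H) (hQ : Q.IsClosed) (D : Submodule ℂ H)
    (h : D ≤ Q.domain) :
    (Q.restrict (Q.formClosure hQ.1 D) (Q.formClosure_le hQ.1 D)).IsClosureOf
      (Q.restrict D h) := by
  obtain ⟨h0, hs, hc⟩ := hQ
  have hK := Q.formClosure_le h0 D
  have hDK : D ≤ Q.formClosure h0 D := fun u hu => ⟨h hu, fun ε hε => ⟨⟨u, h hu⟩, hu, by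
    simpa [normSq] using hε⟩⟩
  refine ⟨⟨fun u => h0 (Submodule.inclusion hK u), fun u v => hs (Submodule.inclusion hK u)
    (Submodule.inclusion hK v), fun u hu => ?_⟩, ⟨hDK, fun u v => rfl⟩, ?_⟩
  · obtain ⟨w, hw⟩ := hc (fun n => Submodule.inclusion hK (u n)) hu
    have hwK : (w : H) ∈ Q.formClosure h0 D := by
      refine ⟨w.2, fun ε hε => ?_⟩
      obtain ⟨n, hn⟩ := ((tendsto_order.1 hw).2 (ε / 4) (by positivity)).exists
      obtain ⟨hun, hun'⟩ := (u n).2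
      obtain ⟨v, hv, hv'⟩ := hun' (ε / 4) (by positivity)
      refine ⟨v, hv, ?_⟩
      have h1 := normSq_sub_le h0 w (Submodule.inclusion hK (u n)) v
      rw [normSq_sub_comm] at hn
      have e : Submodule.inclusion hK (u n) = ⟨_, hun⟩ := rfl
      rw [e] at h1 hn
      change Q.normSq (w - v) < ε
      linarith
    exact ⟨⟨w, hwK⟩, hw⟩
  · rintro Q'' ⟨h0'', hs'', hc''⟩ ⟨hD'', hE⟩
    have approx : ∀ u : Q.domain, (u : H) ∈ Q.formClosure h0 D → ∃ (v : ℕ → Q.domain)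
        (v'' : ℕ → Q''.domain) (u'' : Q''.domain), (∀ n, (v n : H) ∈ D) ∧
        (∀ n, (v n : H) = v'' n) ∧ (u : H) = u'' ∧
        Tendsto (fun n => Q.normSq (v n - u)) atTop (𝓝 0) ∧
        Tendsto (fun n => Q''.normSq (v'' n - u'')) atTop (𝓝 0) := by
      rintro u ⟨_, hu⟩
      choose v hv hv' using fun n : ℕ => hu (1 / ((n : ℝ) + 1)) (by positivity)
      have hlim : Tendsto (fun n => Q.normSq (v n - u)) atTop (𝓝 0) := by
        refine squeeze_zero (fun n => normSq_nonneg h0 _) (fun n => ?_)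
          tendsto_one_div_add_atTop_nhds_zero_nat
        rw [normSq_sub_comm]
        exact (hv' n).le
      have heq : ∀ k l, Q''.normSq (⟨v k, hD'' (hv k)⟩ - ⟨v l, hD'' (hv l)⟩) =
          Q.normSq (v k - v l) := by
        intro k l
        have := hE (⟨v k, hv k⟩ - ⟨v l, hv l⟩) (⟨v k, hv k⟩ - ⟨v l, hv l⟩)
        change Q.toFun (v k - v l) (v k - v l) = Q''.toFun
          (⟨v k, hD'' (hv k)⟩ - ⟨v l, hD'' (hv l)⟩) (⟨v k, hD'' (hv k)⟩ - ⟨v l, hD'' (hv l)⟩) at this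
        simp only [normSq, this, Submodule.coe_sub]
      obtain ⟨w, hw⟩ := hc'' (fun n => ⟨v n, hD'' (hv n)⟩) (by
        intro ε hε
        obtain ⟨N, hN⟩ := eventually_atTop.1 ((tendsto_order.1 hlim).2 (ε / 4) (by positivity))
        refine ⟨N, fun k hk l hl => ?_⟩
        rw [heq]
        have h1 := normSq_sub_le h0 (v k) u (v l)
        rw [normSq_sub_comm Q u] at h1
        linarith [hN k hk, hN l hl])
      exact ⟨v, fun n => ⟨v n, hD'' (hv n)⟩, w, hv, fun n => rfl,
        tendsto_nhds_unique (Q.tendsto_coe h0 hlim) (Q''.tendsto_coe h0'' hw), hlim, hw⟩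
    refine ⟨fun u hu => ?_, fun a b => ?_⟩
    · obtain ⟨_, _, u'', _, _, h1, _⟩ := approx ⟨u, hK hu⟩ hu
      change u = u'' at h1
      rw [h1]; exact u''.2
    · obtain ⟨v, v'', a'', hv, hvv, ha, hl, hl''⟩ := approx ⟨a, hK a.2⟩ a.2
      obtain ⟨w, w'', b'', hw, hww, hb, hm, hm''⟩ := approx ⟨b, hK b.2⟩ b.2
      have hvw : ∀ k l, Q.toFun (v k) (w l) = Q''.toFun (v'' k) (w'' l) := by
        intro k l
        have e1 : v'' k = ⟨v k, hD'' (hv k)⟩ := Subtype.ext (hvv k).symm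
        have e2 : w'' l = ⟨w l, hD'' (hw l)⟩ := Subtype.ext (hww l).symm
        rw [e1, e2]
        exact hE ⟨v k, hv k⟩ ⟨w l, hw l⟩
      have h1 : ∀ l, Q.toFun ⟨a, hK a.2⟩ (w l) = Q''.toFun a'' (w'' l) := fun l =>
        tendsto_nhds_unique (Q.tendsto_left h0 hs hl (w l))
          ((Q''.tendsto_left h0'' hs'' hl'' (w'' l)).congr fun k => (hvw k l).symm)
      have h2 : Q.toFun ⟨a, hK a.2⟩ ⟨b, hK b.2⟩ = Q''.toFun a'' b'' :=
        tendsto_nhds_unique (Q.tendsto_right h0 hs hm _)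
          ((Q''.tendsto_right h0'' hs'' hm'' a'').congr fun l => (h1 l).symm)
      refine h2.trans ?_
      have e1 : a'' = ⟨a, ha ▸ a''.2⟩ := Subtype.ext ha.symm
      have e2 : b'' = ⟨b, hb ▸ b''.2⟩ := Subtype.ext hb.symm
      rw [e1, e2]
      rfl

end SesqForm

namespace WeightedGraph

variable {V : Type*} [MeasurableSpace V] [DiscreteMeasurableSpace V]

theorem neumannForm_isClosed (G : WeightedGraph V) : G.neumannForm.IsClosed := by
  refine ⟨G.neumannForm_isNonneg, fun u v => (G.energy_conj_symm v u).symm, fun u hu => ?_⟩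
  -- the limit in `ℓ²`
  have hcau : CauchySeq fun n => (u n : G.ell2) := by
    rw [Metric.cauchySeq_iff]
    intro ε hε
    obtain ⟨N, hN⟩ := hu (ε ^ 2) (by positivity)
    refine ⟨N, fun k hk l hl => ?_⟩
    rw [dist_eq_norm]
    refine lt_of_pow_lt_pow_left₀ 2 hε.le (lt_of_le_of_lt ?_ (hN k hk l hl))
    exact le_add_of_nonneg_left (G.neumannForm_isNonneg _).1
  obtain ⟨w, hw⟩ := cauchySeq_tendsto_of_complete hcau
  obtain ⟨φ, hφ, hae⟩ := (tendstoInMeasure_of_tendsto_Lp hw).exists_seq_tendsto_ae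
  have hpt : ∀ x, Tendsto (fun k => (u (φ k) : G.ell2) x) atTop (𝓝 (w x)) := G.forall_of_ae hae
  have hfin : ∀ ε > 0, ∃ N, ∀ n ≥ N, ∀ (s : Finset (V × V)) (t : Finset V),
      1 / 2 * ∑ p ∈ s, G.b p.1 p.2 * ‖G.diff ((u n : G.ell2) - w) p‖ ^ 2 +
        ∑ x ∈ t, G.c x * ‖((u n : G.ell2) - w) x‖ ^ 2 ≤ ε := by
    intro ε hε
    obtain ⟨N, hN⟩ := hu ε hε
    refine ⟨N, fun n hn s t => ?_⟩
    have hx : ∀ x, Tendsto (fun k => ((u n : G.ell2) - (u (φ k) : G.ell2)) x) atTop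
        (𝓝 (((u n : G.ell2) - w) x)) := by
      intro x
      simp only [coe_sub]
      exact (hpt x).const_sub _
    have hlim : Tendsto (fun k =>
        1 / 2 * ∑ p ∈ s, G.b p.1 p.2 * ‖G.diff ((u n : G.ell2) - (u (φ k) : G.ell2)) p‖ ^ 2 +
        ∑ x ∈ t, G.c x * ‖((u n : G.ell2) - (u (φ k) : G.ell2)) x‖ ^ 2) atTop
        (𝓝 (1 / 2 * ∑ p ∈ s, G.b p.1 p.2 * ‖G.diff ((u n : G.ell2) - w) p‖ ^ 2 +
        ∑ x ∈ t, G.c x * ‖((u n : G.ell2) - w) x‖ ^ 2)) := by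
      refine Tendsto.add (Tendsto.const_mul _ (tendsto_finsetSum _ fun p _ => ?_))
        (tendsto_finsetSum _ fun x _ => ?_)
      · exact ((((hx p.1).sub (hx p.2)).norm).pow 2).const_mul _
      · exact (((hx x).norm).pow 2).const_mul _
    refine le_of_tendsto hlim ?_
    filter_upwards [hφ.tendsto_atTop.eventually_ge_atTop N] with k hk
    have h1 := hN n hn (φ k) hk
    have h2 : G.HasFiniteEnergy ((u n : G.ell2) - (u (φ k) : G.ell2)) := (u n - u (φ k)).2
    have h3 : G.neumannForm.normSq (u n - u (φ k)) =
        (G.energy ((u n : G.ell2) - (u (φ k) : G.ell2)) ((u n : G.ell2) - (u (φ k) : G.ell2))).re +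
          ‖(u n : G.ell2) - (u (φ k) : G.ell2)‖ ^ 2 := rfl
    rw [energy_self, Complex.ofReal_re] at h3
    have h4 := h2.1.sum_le_tsum s fun p _ => mul_nonneg (G.b_nonneg p.1 p.2) (sq_nonneg _)
    have h5 := h2.2.sum_le_tsum t fun x _ => mul_nonneg (G.c_nonneg x) (sq_nonneg _)
    nlinarith [sq_nonneg ‖(u n : G.ell2) - (u (φ k) : G.ell2)‖]
  have hen : ∀ ε > 0, ∃ N, ∀ n ≥ N, G.HasFiniteEnergy ((u n : G.ell2) - w) ∧
      (G.energy ((u n : G.ell2) - w) ((u n : G.ell2) - w)).re ≤ ε := by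
    intro ε hε
    obtain ⟨N, hN⟩ := hfin ε hε
    refine ⟨N, fun n hn => ?_⟩
    have hb0 := fun p : V × V => mul_nonneg (G.b_nonneg p.1 p.2)
      (sq_nonneg ‖G.diff ((u n : G.ell2) - w) p‖)
    have hc0 := fun x => mul_nonneg (G.c_nonneg x) (sq_nonneg ‖((u n : G.ell2) - w) x‖)
    have hs : G.HasFiniteEnergy ((u n : G.ell2) - w) := by
      refine ⟨summable_of_sum_le (c := 2 * ε) hb0 fun s => ?_,
        summable_of_sum_le (c := ε) hc0 fun t => ?_⟩
      · have := hN n hn s ∅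
        rw [Finset.sum_empty] at this
        linarith
      · have := hN n hn ∅ t
        rw [Finset.sum_empty] at this
        linarith
    refine ⟨hs, ?_⟩
    rw [energy_self, Complex.ofReal_re]
    have hA : Tendsto (fun q : Finset (V × V) × Finset V =>
        1 / 2 * ∑ p ∈ q.1, G.b p.1 p.2 * ‖G.diff ((u n : G.ell2) - w) p‖ ^ 2 +
        ∑ x ∈ q.2, G.c x * ‖((u n : G.ell2) - w) x‖ ^ 2) (atTop ×ˢ atTop)
        (𝓝 (1 / 2 * ∑' p : V × V, G.b p.1 p.2 * ‖G.diff ((u n : G.ell2) - w) p‖ ^ 2 +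
        ∑' x, G.c x * ‖((u n : G.ell2) - w) x‖ ^ 2)) :=
      ((hs.1.hasSum.comp tendsto_fst).const_mul _).add (hs.2.hasSum.comp tendsto_snd)
    exact le_of_tendsto hA (Eventually.of_forall fun q => hN n hn q.1 q.2)
  have hwD : G.HasFiniteEnergy w := by
    obtain ⟨N, hN⟩ := hen 1 one_pos
    have h1 : G.HasFiniteEnergy (u N : G.ell2) := (u N).2
    have := G.neumannDomain.sub_mem h1 (hN N le_rfl).1
    rwa [sub_sub_cancel] at this
  refine ⟨⟨w, hwD⟩, ?_⟩
  have h1 : Tendsto (fun n => ‖(u n : G.ell2) - w‖ ^ 2) atTop (𝓝 0) := by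
    have := (tendsto_iff_norm_sub_tendsto_zero.1 hw).pow 2
    simpa using this
  have h2 : Tendsto (fun n => (G.energy ((u n : G.ell2) - w) ((u n : G.ell2) - w)).re) atTop
      (𝓝 0) := by
    rw [Metric.tendsto_atTop]
    intro ε hε
    obtain ⟨N, hN⟩ := hen (ε / 2) (by positivity)
    refine ⟨N, fun n hn => ?_⟩
    obtain ⟨h3, h4⟩ := hN n hn
    have h5 := (G.neumannForm_isNonneg ⟨_, h3⟩).1
    change 0 ≤ (G.energy ((u n : G.ell2) - w) ((u n : G.ell2) - w)).re at h5
    rw [Real.dist_eq, sub_zero, abs_of_nonneg h5]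
    linarith
  have h6 := h2.add h1
  rw [add_zero] at h6
  exact h6

/-- `Q^(D)` is the closure of `Q^comp`. -/
theorem dirichletForm_isClosureOf (G : WeightedGraph V) :
    G.dirichletForm.IsClosureOf G.compForm :=
  G.neumannForm.restrict_formClosure_isClosureOf G.neumannForm_isClosed G.finSupp G.finSupp_le

end WeightedGraph

/-!
The proof rests on the correspondence between closed forms, their resolvents and self-adjoint
operators, and on the Beurling–Deny type approximation of a Dirichlet form by graph energies.

*Closed forms and operators.* The domain of a closed form `Q` is a Hilbert space for
`Q(u,v) + a ⟨u,v⟩`, and the Riesz representation of `⟨·, f⟩` in it is the resolvent `(L + a)⁻¹ f`.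
The range of the resolvent is a core of `Q`, so a closed form is determined by its resolvent
(`SesqForm.eq_of_resolvent`); in particular the form of an operator does not depend on the choice
of a square root (`SesqForm.IsAssociatedTo.unique`). Conversely, with `R = (L + 1)⁻¹`, the bounded
functional calculus gives `A = R^{1/2}` and `B = (1 - R)^{1/2}`, and from `A² + B² = 1` it follows
that `B A⁻¹` is self-adjoint with square `L = (1 - R) R⁻¹`. Hence every densely defined closed form
has an operator (`SesqForm.exists_isAssociatedTo`).

*Existence.* `Q^(N)` is visibly compatible with normal contractions. For `Q^(D)`, the images under a
contraction of finitely supported functions approximating `u` are bounded in the form norm and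
converge in `ℓ²`, hence weakly in the form norm. That the operators of the two forms are
restrictions of `L̃` is Green's formula `Q^(N)(u, 1ₓ) = m(x) L̃u(x)` (`WeightedGraph.energy_single`).

*The upper bound.* Let `L` be a self-adjoint restriction of `L̃` with form `Q`. By local finiteness
`u ↦ L̃u(x)` is continuous on `ℓ²`, so `1ₓ` lies in the domain of `L* = L`, and `Q` agrees with
`Q^(N)` on the finitely supported functions. As `Q` is closed, it extends `Q^(D)`.

*The lower bound.* Let moreover `Q` be a Dirichlet form and `P = a (L + a)⁻¹`. Since `P f` is the
unique minimizer of `v ↦ Q(v,v) + a ‖v - f‖²`, contracting to `[0,1]` shows `0 ≤ P f ≤ 1` for indicator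
functions `f`. Therefore `a ⟨u, u - P u⟩ ≤ Q(u,u)` dominates the finite parts of the energy of the
graph with edge weights `a ⟨1ₓ, P 1_y⟩` and killing term `a m(x) (1 - P 1(x))`
(`WeightedGraph.IsSymmSubMarkov.sum_le_re_inner`). As `a → ∞` the weights converge to `b(x,y)`, and
the killing term converges to `c(x)`: this uses that `L` is a restriction of `L̃`, in the form
`a (1 - P 1) = L̃ P 1`, together with `P 1 → 1` and local finiteness. This gives
`Q^(N)(u,u) ≤ Q(u,u)`.
-/

/-! ### Closed forms as Hilbert spaces and their resolvents -/

namespace SesqForm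

variable {H : Type*} [NormedAddCommGroup H] [InnerProductSpace ℂ H]

theorem re_inner_self (x : H) : (inner ℂ x x).re = ‖x‖ ^ 2 :=
  inner_self_eq_norm_sq (𝕜 := ℂ) x

/-- The domain of a closed form `Q`, regarded as a Hilbert space for the inner product
`Q(u,v) + a ⟨u,v⟩` with `a > 0`. -/
def FormSpace (Q : SesqForm H) (_ : Q.IsClosed) (a : ℝ) (_ : 0 < a) : Type _ := Q.domain

namespace FormSpace

variable {Q : SesqForm H} {hQ : Q.IsClosed} {a : ℝ} {ha : 0 < a}

noncomputable instance : AddCommGroup (Q.FormSpace hQ a ha) :=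
  inferInstanceAs (AddCommGroup Q.domain)

noncomputable instance : Module ℂ (Q.FormSpace hQ a ha) :=
  inferInstanceAs (Module ℂ Q.domain)

/-- The identity map from the form space to the domain of the form. -/
def toDomain : Q.FormSpace hQ a ha ≃ₗ[ℂ] Q.domain := LinearEquiv.refl ℂ Q.domain

/-- The inner product `Q(u,v) + a ⟨u,v⟩`, with Mathlib's convention of conjugate linearity in the
first argument. -/
@[reducible]
noncomputable def core (Q : SesqForm H) (hQ : Q.IsClosed) (a : ℝ) (ha : 0 < a) :
    InnerProductSpace.Core ℂ (Q.FormSpace hQ a ha) where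
  inner u v := Q.toFun (toDomain v) (toDomain u) +
    a * inner ℂ (toDomain u : H) (toDomain v : H)
  conj_inner_symm u v := by
    rw [map_add, map_mul, inner_conj_symm, ← hQ.2.1, Complex.conj_ofReal]
  re_inner_nonneg u := by
    have h := (hQ.1 (toDomain u)).1
    have h2 := inner_self_nonneg (𝕜 := ℂ) (x := (toDomain u : H))
    simp only [RCLike.re_to_complex, Complex.add_re, Complex.re_ofReal_mul] at h2 ⊢
    positivity
  add_left u v w := by
    simp only [map_add, Submodule.coe_add, inner_add_left]; ring
  smul_left u v r := by
    simp only [map_smul, LinearMap.map_smulₛₗ, smul_eq_mul, Submodule.coe_smul, inner_smul_left]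
    ring
  definite u hu := by
    have h := (hQ.1 (toDomain u)).1
    have h1 := congrArg Complex.re hu
    have h2 : a * ‖(toDomain u : H)‖ ^ 2 = 0 := by
      rw [Complex.add_re, Complex.re_ofReal_mul, re_inner_self, Complex.zero_re] at h1
      have : 0 ≤ a * ‖(toDomain u : H)‖ ^ 2 := by positivity
      linarith
    have h3 : (toDomain u : H) = 0 := by simpa [ha.ne'] using h2
    exact toDomain.injective (by rw [map_zero]; exact Subtype.ext h3)

noncomputable instance : NormedAddCommGroup (Q.FormSpace hQ a ha) :=
  (core Q hQ a ha).toNormedAddCommGroup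

noncomputable instance : InnerProductSpace ℂ (Q.FormSpace hQ a ha) :=
  InnerProductSpace.ofCore (core Q hQ a ha).toCore

theorem inner_def (u v : Q.FormSpace hQ a ha) :
    inner ℂ u v = Q.toFun (toDomain v) (toDomain u) +
      a * inner ℂ (toDomain u : H) (toDomain v : H) := rfl

theorem norm_sq_eq (u : Q.FormSpace hQ a ha) :
    ‖u‖ ^ 2 = (Q.toFun (toDomain u) (toDomain u)).re + a * ‖(toDomain u : H)‖ ^ 2 := by
  rw [← re_inner_self, inner_def, Complex.add_re, Complex.re_ofReal_mul, re_inner_self]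

theorem norm_sq_eq_normSq (u : Q.FormSpace hQ 1 one_pos) : ‖u‖ ^ 2 = Q.normSq (toDomain u) := by
  rw [norm_sq_eq, one_mul]; rfl

theorem norm_sq_le (u : Q.FormSpace hQ a ha) : ‖u‖ ^ 2 ≤ (1 + a) * Q.normSq (toDomain u) := by
  have h := (hQ.1 (toDomain u)).1
  rw [norm_sq_eq, normSq]
  nlinarith [sq_nonneg ‖(toDomain u : H)‖, mul_nonneg ha.le h]

theorem normSq_le (u : Q.FormSpace hQ a ha) :
    Q.normSq (toDomain u) ≤ (1 + a⁻¹) * ‖u‖ ^ 2 := by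
  have h := (hQ.1 (toDomain u)).1
  rw [norm_sq_eq, normSq]
  have e : (1 + a⁻¹) * ((Q.toFun (toDomain u) (toDomain u)).re + a * ‖(toDomain u : H)‖ ^ 2) =
      (1 + a⁻¹) * (Q.toFun (toDomain u) (toDomain u)).re +
      (a + 1) * ‖(toDomain u : H)‖ ^ 2 := by field_simp
  rw [e]
  have h1 : 0 ≤ a⁻¹ * (Q.toFun (toDomain u) (toDomain u)).re := by positivity
  nlinarith [sq_nonneg ‖(toDomain u : H)‖, mul_nonneg ha.le (sq_nonneg ‖(toDomain u : H)‖)]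

instance : CompleteSpace (Q.FormSpace hQ a ha) := by
  refine Metric.complete_of_cauchySeq_tendsto fun u hu => ?_
  obtain ⟨w, hw⟩ := hQ.2.2 (fun n => toDomain (u n)) (by
    intro ε hε
    rw [Metric.cauchySeq_iff] at hu
    have hp : 0 < ε / (1 + a⁻¹) := by positivity
    obtain ⟨N, hN⟩ := hu (√(ε / (1 + a⁻¹))) (Real.sqrt_pos.2 hp)
    refine ⟨N, fun k hk l hl => ?_⟩
    have h1 := hN k hk l hl
    rw [dist_eq_norm, Real.lt_sqrt (norm_nonneg _), lt_div_iff₀ (by positivity)] at h1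
    rw [← map_sub]
    exact (normSq_le _).trans_lt (by linarith))
  refine ⟨toDomain.symm w, ?_⟩
  rw [tendsto_iff_norm_sub_tendsto_zero]
  have h1 : Tendsto (fun n => √((1 + a) * Q.normSq (toDomain (u n) - w))) atTop (𝓝 0) := by
    simpa using (hw.const_mul (1 + a)).sqrt
  refine squeeze_zero (fun n => norm_nonneg _) (fun n => Real.le_sqrt_of_sq_le ?_) h1
  exact (norm_sq_le _).trans_eq (by rw [map_sub, LinearEquiv.apply_symm_apply])

/-- The embedding of the form space into the ambient Hilbert space. -/
noncomputable def embed (Q : SesqForm H) (hQ : Q.IsClosed) (a : ℝ) (ha : 0 < a) :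
    Q.FormSpace hQ a ha →L[ℂ] H :=
  (Q.domain.subtype ∘ₗ (toDomain : Q.FormSpace hQ a ha ≃ₗ[ℂ] Q.domain).toLinearMap).mkContinuous
    (√(a⁻¹)) (fun u => by
      rw [← Real.sqrt_sq (norm_nonneg u), ← Real.sqrt_mul (by positivity)]
      refine Real.le_sqrt_of_sq_le ?_
      have h := (hQ.1 (toDomain u)).1
      rw [inv_mul_eq_div, le_div_iff₀ ha, norm_sq_eq]
      change ‖(toDomain u : H)‖ ^ 2 * a ≤ _
      linarith)

theorem embed_apply (u : Q.FormSpace hQ a ha) : embed Q hQ a ha u = (toDomain u : H) := rfl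

variable [CompleteSpace H]

theorem inner_embed_adjoint (f : H) (v : Q.FormSpace hQ a ha) :
    inner ℂ v ((embed Q hQ a ha).adjoint f) = inner ℂ (toDomain v : H) f := by
  rw [ContinuousLinearMap.adjoint_inner_right, embed_apply]

theorem denseRange_embed_adjoint : DenseRange ((embed Q hQ a ha).adjoint) := by
  have h : ((embed Q hQ a ha).adjoint).range.topologicalClosure = ⊤ := by
    rw [Submodule.topologicalClosure_eq_top_iff, ContinuousLinearMap.orthogonal_range,
      ContinuousLinearMap.adjoint_adjoint, LinearMap.ker_eq_bot]
    intro u v huv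
    exact toDomain.injective (Subtype.ext huv)
  exact (Submodule.dense_iff_topologicalClosure_eq_top.2 h)

end FormSpace

theorem eq_of_isExtendedBy {Q₁ Q₂ : SesqForm H} (h₁ : Q₁.IsExtendedBy Q₂)
    (h₂ : Q₂.IsExtendedBy Q₁) : Q₁ = Q₂ := by
  obtain ⟨D₁, F₁⟩ := Q₁
  obtain ⟨D₂, F₂⟩ := Q₂
  obtain ⟨h, h'⟩ := h₁
  obtain ⟨k, -⟩ := h₂
  obtain rfl : D₁ = D₂ := le_antisymm h k
  congr 1
  ext u v
  exact h' u v

variable [CompleteSpace H]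

/-- The resolvent `(L + a)⁻¹` of the operator of a closed form `Q`: it maps `f` to the element of
`D(Q)` that represents `⟨·, f⟩` for the inner product `Q + a ⟨·,·⟩`. -/
noncomputable def resolvent (Q : SesqForm H) (hQ : Q.IsClosed) (a : ℝ) (ha : 0 < a) : H →L[ℂ] H :=
  FormSpace.embed Q hQ a ha ∘L (FormSpace.embed Q hQ a ha).adjoint

variable {Q : SesqForm H} (hQ : Q.IsClosed) {a : ℝ} (ha : 0 < a)

theorem resolvent_mem (f : H) : Q.resolvent hQ a ha f ∈ Q.domain :=
  (FormSpace.toDomain ((FormSpace.embed Q hQ a ha).adjoint f)).2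

theorem toFun_resolvent (f : H) (v : Q.domain) :
    Q.toFun ⟨Q.resolvent hQ a ha f, resolvent_mem hQ ha f⟩ v +
      a * inner ℂ (v : H) (Q.resolvent hQ a ha f) = inner ℂ (v : H) f :=
  FormSpace.inner_embed_adjoint (hQ := hQ) (ha := ha) f (FormSpace.toDomain.symm v)

theorem toFun_resolvent' (f : H) (v : Q.domain) :
    Q.toFun ⟨Q.resolvent hQ a ha f, resolvent_mem hQ ha f⟩ v =
      inner ℂ (v : H) (f - (a : ℂ) • Q.resolvent hQ a ha f) := by
  rw [inner_sub_right, ← toFun_resolvent hQ ha f v, inner_smul_right]; ring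

theorem inner_resolvent_left (f g : H) :
    inner ℂ (Q.resolvent hQ a ha f) g = inner ℂ f (Q.resolvent hQ a ha g) := by
  simp only [resolvent, ContinuousLinearMap.comp_apply]
  rw [← ContinuousLinearMap.adjoint_inner_right, ContinuousLinearMap.adjoint_inner_left]

theorem resolvent_isPositive : (Q.resolvent hQ a ha).IsPositive :=
  (FormSpace.embed Q hQ a ha).isPositive_self_comp_adjoint

theorem re_toFun_resolvent (f : H) :
    (Q.toFun ⟨Q.resolvent hQ a ha f, resolvent_mem hQ ha f⟩
      ⟨Q.resolvent hQ a ha f, resolvent_mem hQ ha f⟩).re + a * ‖Q.resolvent hQ a ha f‖ ^ 2 =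
    (inner ℂ (Q.resolvent hQ a ha f) f).re := by
  have h := congrArg Complex.re (toFun_resolvent hQ ha f ⟨_, resolvent_mem hQ ha f⟩)
  rwa [Complex.add_re, Complex.re_ofReal_mul, re_inner_self] at h

/-- The range of the resolvent is a core of the form. -/
theorem mem_formClosure_range_resolvent (u : Q.domain) :
    (u : H) ∈ Q.formClosure hQ.1 (Q.resolvent hQ a ha).range := by
  refine ⟨u.2, fun ε hε => ?_⟩
  have hp : 0 < ε / (1 + a⁻¹) := by positivity
  obtain ⟨f, hf⟩ := (FormSpace.denseRange_embed_adjoint (hQ := hQ) (ha := ha)).exists_dist_lt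
    (FormSpace.toDomain.symm u) (Real.sqrt_pos.2 hp)
  refine ⟨⟨_, resolvent_mem hQ ha f⟩, ⟨f, rfl⟩, ?_⟩
  rw [dist_eq_norm, Real.lt_sqrt (norm_nonneg _), lt_div_iff₀ (by positivity)] at hf
  have h := FormSpace.normSq_le (FormSpace.toDomain.symm u -
    (FormSpace.embed Q hQ a ha).adjoint f)
  rw [mul_comm] at hf
  exact h.trans_lt hf

/-- A bounded sequence in the form norm that converges in `H` converges weakly in the form space;
hence the form norm closure of a subspace contains the limit as soon as the latter is in the
domain. -/
theorem mem_formClosure_of_tendsto {D : Submodule ℂ H} {u : ℕ → Q.domain} {M : ℝ}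
    (huD : ∀ n, (u n : H) ∈ D) (hM : ∀ n, Q.normSq (u n) ≤ M) {w : Q.domain}
    (hw : Tendsto (fun n => (u n : H)) atTop (𝓝 (w : H))) :
    (w : H) ∈ Q.formClosure hQ.1 D := by
  let E := Q.FormSpace hQ 1 one_pos
  let e : E ≃ₗ[ℂ] Q.domain := FormSpace.toDomain
  let D' : Submodule ℂ E := D.comap (Q.domain.subtype ∘ₗ e.toLinearMap)
  have hC : ∀ n, ‖e.symm (u n) - e.symm w‖ ≤ √M + ‖e.symm w‖ := fun n => by
    refine (norm_sub_le _ _).trans (add_le_add_left (Real.le_sqrt_of_sq_le ?_) _)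
    rw [FormSpace.norm_sq_eq_normSq]
    exact hM n
  have key : e.symm w ∈ D'.topologicalClosure := by
    rw [← Submodule.orthogonal_orthogonal_eq_closure, Submodule.mem_orthogonal]
    intro k hk
    have hk0 : ∀ n, inner ℂ k (e.symm (u n)) = 0 := fun n =>
      (Submodule.mem_orthogonal' _ _).1 hk _ (by
        change ((e (e.symm (u n)) : Q.domain) : H) ∈ D
        rw [LinearEquiv.apply_symm_apply]; exact huD n)
    by_contra hne
    have hpos : 0 < ‖inner ℂ k (e.symm w)‖ := norm_pos_iff.2 hne
    set δ := ‖inner ℂ k (e.symm w)‖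
    -- approximate `k` by a vector that represents `⟨f, ·⟩`, on which convergence in `H` suffices
    set C := √M + ‖e.symm w‖ + 1
    have hCpos : 0 < C := by positivity
    obtain ⟨f, hf⟩ := (FormSpace.denseRange_embed_adjoint (hQ := hQ) (ha := one_pos)).exists_dist_lt
      k (show 0 < δ / (2 * C) by positivity)
    rw [dist_eq_norm] at hf
    have hlim : Tendsto (fun n => ‖inner ℂ f ((u n : H) - w)‖) atTop (𝓝 0) := by
      have h1 : Tendsto (fun n => inner ℂ f ((u n : H) - w)) atTop (𝓝 (inner ℂ f ((w : H) - w))) :=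
        Tendsto.inner tendsto_const_nhds (hw.sub tendsto_const_nhds)
      simpa using h1.norm
    obtain ⟨n, hn⟩ := ((tendsto_order.1 hlim).2 (δ / 2) (by positivity)).exists
    set g := (FormSpace.embed Q hQ 1 one_pos).adjoint f
    have h1 : inner ℂ k (e.symm w) =
        -(inner ℂ (k - g) (e.symm (u n) - e.symm w) + inner ℂ g (e.symm (u n) - e.symm w)) := by
      rw [← inner_add_left, sub_add_cancel, inner_sub_right, hk0 n]; ring
    have h2 : inner ℂ g (e.symm (u n) - e.symm w) = inner ℂ f ((u n : H) - w) := by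
      rw [ContinuousLinearMap.adjoint_inner_left, map_sub]; rfl
    have h3 : ‖inner ℂ (k - g) (e.symm (u n) - e.symm w)‖ ≤ δ / (2 * C) * C := by
      refine (norm_inner_le_norm _ _).trans (mul_le_mul hf.le ((hC n).trans ?_) (norm_nonneg _)
        (by positivity))
      simp [C]
    have h4 : δ / (2 * C) * C = δ / 2 := by field_simp
    have h5 : δ ≤ ‖inner ℂ (k - g) (e.symm (u n) - e.symm w)‖ + ‖inner ℂ f ((u n : H) - w)‖ := by
      rw [← h2]
      calc δ = _ := congrArg norm h1
        _ ≤ _ := by rw [norm_neg]; exact norm_add_le _ _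
    linarith
  refine ⟨w.2, fun ε hε => ?_⟩
  obtain ⟨v, hv, hvw⟩ := Metric.mem_closure_iff.1 key (√ε) (Real.sqrt_pos.2 hε)
  refine ⟨e v, hv, ?_⟩
  rw [dist_eq_norm, Real.lt_sqrt (norm_nonneg _), FormSpace.norm_sq_eq_normSq] at hvw
  exact hvw

/-! ### Uniqueness of a closed form with given resolvent -/

theorem isExtendedBy_of_resolvent {Q₁ Q₂ : SesqForm H} (h₁ : Q₁.IsClosed) (h₂ : Q₂.IsClosed)
    (h : ∀ f, ∃ hm : Q₁.resolvent h₁ 1 one_pos f ∈ Q₂.domain, ∀ v : Q₂.domain,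
      Q₂.toFun ⟨_, hm⟩ v = inner ℂ (v : H) (f - Q₁.resolvent h₁ 1 one_pos f)) :
    Q₁.IsExtendedBy Q₂ := by
  set D := (Q₁.resolvent h₁ 1 one_pos).range
  have hD : D ≤ Q₁.domain := by rintro _ ⟨f, rfl⟩; exact resolvent_mem h₁ one_pos f
  have hcl := (Q₁.restrict_formClosure_isClosureOf h₁ D hD).2.2 Q₂ h₂ (by
    refine ⟨by rintro _ ⟨f, rfl⟩; exact (h f).1, ?_⟩
    rintro ⟨_, f, rfl⟩ ⟨v, hv⟩
    obtain ⟨hm, hf⟩ := h f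
    refine (toFun_resolvent' h₁ one_pos f ⟨v, hD hv⟩).trans ?_
    rw [Complex.ofReal_one, one_smul]
    exact (hf ⟨v, _⟩).symm)
  obtain ⟨hle, he⟩ := hcl
  have hsub : Q₁.domain ≤ Q₁.formClosure h₁.1 D := fun u hu =>
    mem_formClosure_range_resolvent h₁ one_pos ⟨u, hu⟩
  exact ⟨hsub.trans hle, fun u v => he ⟨u, hsub u.2⟩ ⟨v, hsub v.2⟩⟩

/-- A closed form is determined by its resolvent: if `Q₂` satisfies the equation defining the
resolvent of `Q₁`, then the two forms agree. -/
theorem eq_of_resolvent {Q₁ Q₂ : SesqForm H} (h₁ : Q₁.IsClosed) (h₂ : Q₂.IsClosed)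
    (h : ∀ f, ∃ hm : Q₁.resolvent h₁ 1 one_pos f ∈ Q₂.domain, ∀ v : Q₂.domain,
      Q₂.toFun ⟨_, hm⟩ v = inner ℂ (v : H) (f - Q₁.resolvent h₁ 1 one_pos f)) : Q₁ = Q₂ := by
  refine eq_of_isExtendedBy (isExtendedBy_of_resolvent h₁ h₂ h)
    (isExtendedBy_of_resolvent h₂ h₁ fun f => ?_)
  -- both resolvents solve the same equation in `D(Q₂)`, so they are equal
  have e : Q₂.resolvent h₂ 1 one_pos f = Q₁.resolvent h₁ 1 one_pos f := by
    obtain ⟨hm, hf⟩ := h f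
    set r₁ : Q₂.domain := ⟨_, hm⟩
    set r₂ : Q₂.domain := ⟨_, resolvent_mem h₂ one_pos f⟩
    have h3 := hf (r₂ - r₁)
    have h4 := toFun_resolvent' h₂ one_pos f (r₂ - r₁)
    have h5 : Q₂.toFun (r₂ - r₁) (r₂ - r₁) = - inner ℂ ((r₂ - r₁ : Q₂.domain) : H)
        ((r₂ - r₁ : Q₂.domain) : H) := by
      rw [map_sub Q₂.toFun, LinearMap.sub_apply, h4, h3, ← inner_sub_right, ← inner_neg_right]
      congr 1
      simp [r₁, r₂]
    have h6 := (h₂.1 (r₂ - r₁)).1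
    rw [h5, Complex.neg_re, re_inner_self] at h6
    have h7 : ‖((r₂ - r₁ : Q₂.domain) : H)‖ = 0 := by
      have := sq_nonneg ‖((r₂ - r₁ : Q₂.domain) : H)‖
      exact pow_eq_zero_iff two_ne_zero |>.1 (by linarith)
    exact sub_eq_zero.1 (norm_eq_zero.1 h7)
  refine ⟨e ▸ resolvent_mem h₁ one_pos f, fun v => ?_⟩
  have h2 := toFun_resolvent' h₁ one_pos f v
  rw [Complex.ofReal_one, one_smul] at h2
  simp only [e]
  exact h2

end SesqForm

/-! ### Self-adjoint operators and their associated forms -/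

namespace SesqForm

variable {H : Type*} [NormedAddCommGroup H] [InnerProductSpace ℂ H]

theorem re_toFun_add {Q : SesqForm H} (hQ : Q.IsSymmetric) (u v : Q.domain) :
    (Q.toFun (u + v) (u + v)).re =
      (Q.toFun u u).re + 2 * (Q.toFun u v).re + (Q.toFun v v).re := by
  have h : (Q.toFun v u).re = (Q.toFun u v).re := by rw [hQ v u, Complex.conj_re]
  simp only [map_add, LinearMap.add_apply, Complex.add_re, h]
  ring

/-- The operator whose graph is `{(Ax, Bx)}`, that is, `B A⁻¹` for injective `A`. -/
noncomputable def quotientOp (A B : H →L[ℂ] H) : H →ₗ.[ℂ] H :=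
  (A.prod B).range.toLinearPMap

theorem mem_graph_quotientOp {A B : H →L[ℂ] H} (hA : Function.Injective A) {u w : H} :
    (u, w) ∈ (quotientOp A B).graph ↔ ∃ x, A x = u ∧ B x = w := by
  rw [quotientOp, Submodule.toLinearPMap_graph_eq]
  · simp [Prod.ext_iff]
  · rintro _ ⟨x, rfl⟩ hx
    have : x = 0 := hA (hx.trans (map_zero A).symm)
    simp [this]

variable [CompleteSpace H]

theorem mem_graph_iff_of_isSelfAdjoint {S : H →ₗ.[ℂ] H} (hS : IsSelfAdjoint S) {z w : H} :
    (z, w) ∈ S.graph ↔ ∀ v : S.domain, inner ℂ (S v) z = inner ℂ (v : H) w := by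
  have h : S.graph = S.graph.adjoint := by
    rw [← LinearPMap.adjoint_graph_eq_graph_adjoint hS.dense_domain,
      LinearPMap.isSelfAdjoint_def.1 hS]
  rw [h, Submodule.mem_adjoint_iff]
  constructor
  · intro h v
    exact sub_eq_zero.1 (h v (S v) (S.mem_graph v))
  · intro h a b hab
    obtain ⟨y, rfl, rfl⟩ := (LinearPMap.mem_graph_iff S).1 hab
    exact sub_eq_zero.2 (h y)

theorem IsAssociatedTo.mem_graph_iff {Q : SesqForm H} {L : H →ₗ.[ℂ] H} (hQ : Q.IsAssociatedTo L)
    {u w : H} : (u, w) ∈ L.graph ↔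
      ∃ h : u ∈ Q.domain, ∀ v : Q.domain, Q.toFun ⟨u, h⟩ v = inner ℂ (v : H) w := by
  obtain ⟨D, F⟩ := Q
  obtain ⟨S, ⟨hS, -, hL⟩, h, hF⟩ := hQ
  dsimp only at h hF ⊢
  subst h
  rw [hL]
  constructor
  · rintro ⟨z, hz, hw⟩
    obtain ⟨y, rfl, rfl⟩ := (LinearPMap.mem_graph_iff S).1 hz
    exact ⟨y.2, fun v => (hF y v).trans ((mem_graph_iff_of_isSelfAdjoint hS).1 hw v)⟩
  · rintro ⟨hu, h⟩
    exact ⟨S ⟨u, hu⟩, S.mem_graph ⟨u, hu⟩, (mem_graph_iff_of_isSelfAdjoint hS).2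
      fun v => (hF ⟨u, hu⟩ v).symm.trans (h v)⟩

/-- The form `⟨Su, Sv⟩` of a self-adjoint operator is closed because `S` is. -/
theorem IsAssociatedTo.isClosed {Q : SesqForm H} {L : H →ₗ.[ℂ] H} (hQ : Q.IsAssociatedTo L) :
    Q.IsClosed := by
  obtain ⟨D, F⟩ := Q
  obtain ⟨S, ⟨hS, -, -⟩, h, hF⟩ := hQ
  dsimp only at h hF
  subst h
  replace hF : ∀ u v : S.domain, F u v = inner ℂ (S v) (S u) := hF
  have hself : ∀ u : S.domain, F u u = ((‖S u‖ ^ 2 : ℝ) : ℂ) := fun u => by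
    rw [hF, inner_self_eq_norm_sq_to_K]; norm_cast
  have hn : ∀ u : S.domain, (⟨S.domain, F⟩ : SesqForm H).normSq u = ‖S u‖ ^ 2 + ‖(u : H)‖ ^ 2 :=
    fun u => by
      change (F u u).re + ‖(u : H)‖ ^ 2 = _
      rw [hself, Complex.ofReal_re]
  refine ⟨fun u => ?_, fun u v => ?_, fun u hu => ?_⟩
  · change 0 ≤ (F u u).re ∧ (F u u).im = 0
    rw [hself, Complex.ofReal_re, Complex.ofReal_im]
    exact ⟨by positivity, rfl⟩
  · change F u v = conj (F v u)
    rw [hF, hF, inner_conj_symm]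
  have hcau1 : CauchySeq fun n => (u n : H) := by
    rw [Metric.cauchySeq_iff]
    intro ε hε
    obtain ⟨N, hN⟩ := hu (ε ^ 2) (by positivity)
    refine ⟨N, fun k hk l hl => lt_of_pow_lt_pow_left₀ 2 hε.le (lt_of_le_of_lt ?_ (hN k hk l hl))⟩
    rw [hn, dist_eq_norm]
    exact le_add_of_nonneg_left (sq_nonneg _)
  have hcau2 : CauchySeq fun n => S (u n) := by
    rw [Metric.cauchySeq_iff]
    intro ε hε
    obtain ⟨N, hN⟩ := hu (ε ^ 2) (by positivity)
    refine ⟨N, fun k hk l hl => lt_of_pow_lt_pow_left₀ 2 hε.le (lt_of_le_of_lt ?_ (hN k hk l hl))⟩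
    rw [hn, dist_eq_norm, ← LinearPMap.map_sub]
    exact le_add_of_nonneg_right (sq_nonneg _)
  obtain ⟨w, hw⟩ := cauchySeq_tendsto_of_complete hcau1
  obtain ⟨z, hz⟩ := cauchySeq_tendsto_of_complete hcau2
  have hg : (w, z) ∈ S.graph :=
    hS.isClosed.mem_of_tendsto (hw.prodMk_nhds hz) (Eventually.of_forall fun n => S.mem_graph (u n))
  obtain ⟨y, rfl, rfl⟩ := (LinearPMap.mem_graph_iff S).1 hg
  refine ⟨y, ?_⟩
  simp_rw [hn]
  have h1 := (tendsto_iff_norm_sub_tendsto_zero.1 hw).pow 2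
  have h2 := (tendsto_iff_norm_sub_tendsto_zero.1 hz).pow 2
  simpa [LinearPMap.map_sub] using h2.add h1

/-- The operator of an associated form maps `(L + a)⁻¹ f` to `f - a (L + a)⁻¹ f`. -/
theorem IsAssociatedTo.resolvent_mem_graph {Q : SesqForm H} {L : H →ₗ.[ℂ] H}
    (hQ : Q.IsAssociatedTo L) (hc : Q.IsClosed) {a : ℝ} (ha : 0 < a) (f : H) :
    (Q.resolvent hc a ha f, f - (a : ℂ) • Q.resolvent hc a ha f) ∈ L.graph :=
  hQ.mem_graph_iff.2 ⟨resolvent_mem hc ha f, toFun_resolvent' hc ha f⟩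

/-- The form of an operator does not depend on the choice of the square root. -/
theorem IsAssociatedTo.unique {Q₁ Q₂ : SesqForm H} {L : H →ₗ.[ℂ] H} (h₁ : Q₁.IsAssociatedTo L)
    (h₂ : Q₂.IsAssociatedTo L) : Q₁ = Q₂ := by
  refine eq_of_resolvent h₁.isClosed h₂.isClosed fun f => ?_
  have h := h₁.resolvent_mem_graph h₁.isClosed one_pos f
  rw [Complex.ofReal_one, one_smul] at h
  exact h₂.mem_graph_iff.1 h

/-! ### The operator of a closed form -/

theorem isNonneg_quotientOp {A B : H →L[ℂ] H} (hA : Function.Injective A) (hA0 : 0 ≤ A)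
    (hB0 : 0 ≤ B) (hAB : Commute A B) : (quotientOp A B).IsNonneg := by
  intro u
  obtain ⟨x, hx, hx'⟩ := (mem_graph_quotientOp hA).1 ((quotientOp A B).mem_graph u)
  rw [← hx, ← hx']
  have hAs := (ContinuousLinearMap.nonneg_iff_isPositive A).1 hA0
  have h := (ContinuousLinearMap.nonneg_iff_isPositive _).1 (hAB.mul_nonneg hA0 hB0)
  have e : inner ℂ (A x) (B x) = inner ℂ x ((A * B) x) := hAs.isSymmetric x (B x)
  rw [e]
  exact h.re_inner_nonneg_right x

theorem isSelfAdjoint_quotientOp {A B : H →L[ℂ] H} (hA : Function.Injective A) (hA0 : 0 ≤ A)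
    (hB0 : 0 ≤ B) (hAB : Commute A B) (h : ∀ u w, B u = A w → ∃ x, A x = u ∧ B x = w) :
    IsSelfAdjoint (quotientOp A B) := by
  have hAs := ((ContinuousLinearMap.nonneg_iff_isPositive A).1 hA0).isSymmetric
  have hBs := ((ContinuousLinearMap.nonneg_iff_isPositive B).1 hB0).isSymmetric
  have hd : Dense ((quotientOp A B).domain : Set H) := by
    rw [Submodule.dense_iff_topologicalClosure_eq_top, Submodule.topologicalClosure_eq_top_iff,
      Submodule.eq_bot_iff]
    intro y hy
    refine hA ((inner_self_eq_zero (𝕜 := ℂ)).1 ?_ |>.trans (map_zero A).symm)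
    have hm : (A (A y), B (A y)) ∈ (quotientOp A B).graph :=
      (mem_graph_quotientOp hA).2 ⟨A y, rfl, rfl⟩
    obtain ⟨v, hv, -⟩ := (LinearPMap.mem_graph_iff _).1 hm
    have hv' : A (A y) ∈ (quotientOp A B).domain := by rw [← show _ = A (A y) from hv]; exact v.2
    exact (hAs y (A y)).trans ((Submodule.mem_orthogonal' _ _).1 hy _ hv')
  rw [LinearPMap.isSelfAdjoint_def]
  refine LinearPMap.eq_of_eq_graph ?_
  rw [LinearPMap.adjoint_graph_eq_graph_adjoint hd]
  ext ⟨u, w⟩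
  rw [Submodule.mem_adjoint_iff, mem_graph_quotientOp hA]
  constructor
  · intro hu
    refine h u w (ext_inner_left ℂ fun x => ?_)
    have := hu (A x) (B x) ((mem_graph_quotientOp hA).2 ⟨x, rfl, rfl⟩)
    exact ((hBs x u).symm.trans (sub_eq_zero.1 this)).trans (hAs x w)
  · rintro ⟨x, rfl, rfl⟩ a b hab
    obtain ⟨y, rfl, rfl⟩ := (mem_graph_quotientOp hA).1 hab
    have e : B (A x) = A (B x) := (DFunLike.congr_fun hAB.eq x).symm
    exact sub_eq_zero.2 (((hBs y (A x)).trans (congrArg (inner ℂ y) e)).trans (hAs y (B x)).symm)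

/-- Every densely defined closed form is the form of a non-negative self-adjoint operator. With the
resolvent `R = (L + 1)⁻¹` of the form, `A = R^{1/2}` and `B = (1 - R)^{1/2}`, the operator is
`L = (1 - R) R⁻¹` and its square root is `B A⁻¹`. -/
theorem exists_isAssociatedTo {Q : SesqForm H} (hQ : Q.IsClosed)
    (hd : Dense (Q.domain : Set H)) :
    ∃ L : H →ₗ.[ℂ] H, IsSelfAdjoint L ∧ L.IsNonneg ∧ Q.IsAssociatedTo L := by
  set R := Q.resolvent hQ 1 one_pos with hR
  have hR0 : 0 ≤ R := (ContinuousLinearMap.nonneg_iff_isPositive R).2 (resolvent_isPositive hQ _)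
  have hRinj : Function.Injective R := by
    refine (injective_iff_map_eq_zero R).2 fun f hf => ?_
    refine hd.eq_zero_of_inner_right ℂ fun v hv => ?_
    have h := toFun_resolvent hQ one_pos f ⟨v, hv⟩
    have e : (⟨R f, resolvent_mem hQ one_pos f⟩ : Q.domain) = 0 := Subtype.ext hf
    have h0 : inner ℂ v (R f) = 0 := by rw [hf, inner_zero_right]
    refine h.symm.trans ?_
    rw [show (⟨Q.resolvent hQ 1 one_pos f, resolvent_mem hQ one_pos f⟩ : Q.domain) = 0 from e,
      map_zero, LinearMap.zero_apply, zero_add]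
    exact mul_eq_zero_of_right _ h0
  have hB0 : 0 ≤ 1 - R := by
    rw [ContinuousLinearMap.nonneg_iff_isPositive]
    refine ⟨fun f g => ?_, fun f => ?_⟩
    · change inner ℂ (f - R f) g = inner ℂ f (g - R g)
      rw [inner_sub_left, inner_sub_right, inner_resolvent_left]
    · change 0 ≤ (inner ℂ (f - R f) f).re
      rw [inner_sub_left, Complex.sub_re, re_inner_self]
      have h1 := re_toFun_resolvent hQ one_pos f
      have h2 := (hQ.1 ⟨R f, resolvent_mem hQ one_pos f⟩).1
      have h3 : (inner ℂ (R f) f).re ≤ ‖R f‖ * ‖f‖ := re_inner_le_norm (𝕜 := ℂ) (R f) f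
      change (Q.toFun ⟨R f, _⟩ ⟨R f, _⟩).re + 1 * ‖R f‖ ^ 2 = (inner ℂ (R f) f).re at h1
      nlinarith [sq_nonneg (‖R f‖ - ‖f‖), sq_nonneg (‖R f‖)]
  set A := CFC.sqrt R
  set B := CFC.sqrt (1 - R)
  have hAA : A * A = R := CFC.sqrt_mul_sqrt_self R
  have hBB : B * B = 1 - R := CFC.sqrt_mul_sqrt_self (1 - R)
  have hRB : Commute R B :=
    (((Commute.one_left R).sub_left (Commute.refl R)).cfcₙ_nnreal NNReal.sqrt).symm
  have hAB : Commute A B := hRB.cfcₙ_nnreal NNReal.sqrt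
  have hA0 : 0 ≤ A := CFC.sqrt_nonneg R
  have hB0' : 0 ≤ B := CFC.sqrt_nonneg (1 - R)
  have eAA : ∀ x, A (A x) = R x := fun x => DFunLike.congr_fun hAA x
  have eBB : ∀ x, B (B x) = x - R x := fun x => DFunLike.congr_fun hBB x
  have eAB : ∀ x, A (B x) = B (A x) := fun x => DFunLike.congr_fun hAB.eq x
  have hAinj : Function.Injective A := fun x y hxy => hRinj (by rw [← eAA, ← eAA, hxy])
  -- since `A² + B² = 1`, the equation `B u = A w` is solved by `x = A u + B w`
  have hsolve : ∀ u w, B u = A w → ∃ x, A x = u ∧ B x = w := by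
    intro u w h
    refine ⟨A u + B w, ?_, ?_⟩
    · rw [map_add, eAA, eAB, ← h, eBB]; abel
    · rw [map_add, eBB, ← eAB, h, eAA]; abel
  have hRS : Commute R (1 - R) := (Commute.one_right R).sub_right (Commute.refl R)
  have hLsa : IsSelfAdjoint (quotientOp R (1 - R)) :=
    isSelfAdjoint_quotientOp hRinj hR0 hB0 hRS fun u w h => by
      change u - R u = R w at h
      refine ⟨u + w, ?_, ?_⟩
      · rw [map_add, ← h]; abel
      · change (u + w) - R (u + w) = w
        rw [map_add, ← h]; abel
  have hSsa := isSelfAdjoint_quotientOp hAinj hA0 hB0' hAB hsolve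
  have hsq : (quotientOp A B).IsSqrtOf (quotientOp R (1 - R)) := by
    refine ⟨hSsa, isNonneg_quotientOp hAinj hA0 hB0' hAB, fun u w => ?_⟩
    simp only [mem_graph_quotientOp hAinj, mem_graph_quotientOp hRinj]
    constructor
    · rintro ⟨z, rfl, rfl⟩
      exact ⟨B (A z), ⟨A z, eAA z, rfl⟩, B z, eAB z, eBB z⟩
    · rintro ⟨_, ⟨x, rfl, rfl⟩, y, hy, rfl⟩
      obtain ⟨z, rfl, rfl⟩ := hsolve x y hy.symm
      exact ⟨z, (eAA z).symm, (eBB z).symm⟩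
  let Q' : SesqForm H :=
    { domain := (quotientOp A B).domain
      toFun := LinearMap.mk₂'ₛₗ (RingHom.id ℂ) (starRingEnd ℂ)
        (fun u v => inner ℂ (quotientOp A B v) (quotientOp A B u))
        (by intros; rw [LinearPMap.map_add, inner_add_right])
        (by intros; rw [LinearPMap.map_smul, inner_smul_right]; rfl)
        (by intros; rw [LinearPMap.map_add, inner_add_left])
        (by intros; rw [LinearPMap.map_smul, inner_smul_left]; rfl) }
  have hQ' : Q'.IsAssociatedTo (quotientOp R (1 - R)) := ⟨_, hsq, rfl, fun u v => rfl⟩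
  have e : Q = Q' := eq_of_resolvent hQ hQ'.isClosed fun f =>
    hQ'.mem_graph_iff.1 ((mem_graph_quotientOp hRinj).2 ⟨f, rfl, rfl⟩)
  exact ⟨_, hLsa, isNonneg_quotientOp hRinj hR0 hB0 hRS, e ▸ hQ'⟩

/-! ### Resolvents of Dirichlet forms -/

variable {Q : SesqForm H} (hQ : Q.IsClosed) {a : ℝ} (ha : 0 < a)

/-- The operator `a (L + a)⁻¹`, where `L` is the operator of the closed form `Q`. -/
noncomputable def approx (Q : SesqForm H) (hQ : Q.IsClosed) (a : ℝ) (ha : 0 < a) : H →L[ℂ] H :=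
  (a : ℂ) • Q.resolvent hQ a ha

theorem approx_mem (f : H) : Q.approx hQ a ha f ∈ Q.domain :=
  Q.domain.smul_mem _ (resolvent_mem hQ ha f)

theorem toFun_approx (f : H) (v : Q.domain) :
    Q.toFun ⟨Q.approx hQ a ha f, approx_mem hQ ha f⟩ v =
      a * inner ℂ (v : H) (f - Q.approx hQ a ha f) := by
  have h : (⟨Q.approx hQ a ha f, approx_mem hQ ha f⟩ : Q.domain) =
      (a : ℂ) • ⟨Q.resolvent hQ a ha f, resolvent_mem hQ ha f⟩ := rfl
  rw [h, map_smul, LinearMap.smul_apply, toFun_resolvent', smul_eq_mul]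
  rfl

theorem inner_approx_left (f g : H) :
    inner ℂ (Q.approx hQ a ha f) g = inner ℂ f (Q.approx hQ a ha g) := by
  simp only [approx, _root_.smul_apply, inner_smul_left, inner_smul_right,
    inner_resolvent_left, Complex.conj_ofReal]

theorem re_inner_approx_add_le (u : Q.domain) :
    a * (inner ℂ (u : H) (u - Q.approx hQ a ha u)).re + a * ‖(u : H) - Q.approx hQ a ha u‖ ^ 2 ≤
      (Q.toFun u u).re := by
  set w : Q.domain := ⟨Q.approx hQ a ha u, approx_mem hQ ha u⟩
  have h1 := re_toFun_add hQ.2.1 w (u - w)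
  rw [add_sub_cancel, toFun_approx, toFun_approx] at h1
  have h2 := (hQ.1 (u - w)).1
  have h3 : inner ℂ (w : H) ((u : H) - Q.approx hQ a ha u) =
      inner ℂ (u : H) ((u : H) - Q.approx hQ a ha u) -
      inner ℂ ((u : H) - w) ((u : H) - w) := by
    rw [← inner_sub_left, sub_sub_cancel]
  have h4 : inner ℂ ((u - w : Q.domain) : H) ((u : H) - Q.approx hQ a ha u) =
    inner ℂ ((u : H) - w) ((u : H) - w) := rfl
  rw [h3, h4, Complex.re_ofReal_mul, Complex.re_ofReal_mul, Complex.sub_re, re_inner_self] at h1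
  have h5 : ‖(u : H) - w‖ = ‖(u : H) - Q.approx hQ a ha u‖ := rfl
  rw [h5] at h1
  linarith

theorem re_inner_sub_approx_nonneg (u : H) :
    0 ≤ (inner ℂ u (u - Q.approx hQ a ha u)).re := by
  have h1 := (hQ.1 ⟨_, approx_mem hQ ha u⟩).1
  rw [toFun_approx, Complex.re_ofReal_mul] at h1
  have h2 : inner ℂ u (u - Q.approx hQ a ha u) = inner ℂ (Q.approx hQ a ha u)
      (u - Q.approx hQ a ha u) + inner ℂ (u - Q.approx hQ a ha u) (u - Q.approx hQ a ha u) := by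
    rw [← inner_add_left, add_sub_cancel]
  rw [h2, Complex.add_re, re_inner_self]
  exact add_nonneg (nonneg_of_mul_nonneg_right h1 ha) (sq_nonneg _)

/-- The form `a ⟨u - a (L + a)⁻¹ u, u⟩` approximates `Q` from below. -/
theorem re_inner_approx_le (u : Q.domain) :
    a * (inner ℂ (u : H) (u - Q.approx hQ a ha u)).re ≤ (Q.toFun u u).re := by
  have := re_inner_approx_add_le hQ ha u
  have : 0 ≤ a * ‖(u : H) - Q.approx hQ a ha u‖ ^ 2 := by positivity
  linarith

theorem norm_sub_approx_sq_le (u : Q.domain) :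
    a * ‖(u : H) - Q.approx hQ a ha u‖ ^ 2 ≤ (Q.toFun u u).re := by
  have := re_inner_approx_add_le hQ ha u
  have := mul_nonneg ha.le (re_inner_sub_approx_nonneg hQ ha (u : H))
  linarith

theorem tendsto_approx (u : Q.domain) :
    Tendsto (fun n : ℕ => Q.approx hQ ((n : ℝ) + 1) n.cast_add_one_pos (u : H)) atTop
      (𝓝 (u : H)) := by
  rw [tendsto_iff_norm_sub_tendsto_zero]
  have h1 : Tendsto (fun n : ℕ => √((Q.toFun u u).re * (1 / ((n : ℝ) + 1)))) atTop (𝓝 0) := by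
    simpa using (tendsto_one_div_add_atTop_nhds_zero_nat.const_mul (Q.toFun u u).re).sqrt
  refine squeeze_zero (fun n => norm_nonneg _) (fun n => Real.le_sqrt_of_sq_le ?_) h1
  rw [mul_one_div, le_div_iff₀ (by positivity), mul_comm, norm_sub_rev]
  exact norm_sub_approx_sq_le hQ n.cast_add_one_pos u

/-- If a normal contraction `C` fixes `f`, then it fixes `w = a (L + a)⁻¹ f`: this `w` is the unique
minimizer of `v ↦ Q(v,v) + a ‖v - f‖²`, and `C` increases neither term. -/
theorem IsDirichletForm.compLp_approx {X : Type*} [MeasurableSpace X] {μ : Measure X}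
    {Q : SesqForm (Lp ℂ 2 μ)} (hQ : Q.IsClosed) (hD : Q.IsDirichletForm) {a : ℝ} (ha : 0 < a) {C : ℂ → ℂ}
    (hC : LipschitzWith 1 C) (h0 : C 0 = 0) {f : Lp ℂ 2 μ} (hf : hC.compLp h0 f = f) :
    hC.compLp h0 (Q.approx hQ a ha f) = Q.approx hQ a ha f := by
  set w : Q.domain := ⟨Q.approx hQ a ha f, approx_mem hQ ha f⟩ with hw
  obtain ⟨hm, hle⟩ := hD.2 C hC h0 w
  set w' : Q.domain := ⟨_, hm⟩
  have h1 := re_toFun_add hQ.2.1 w (w' - w)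
  rw [add_sub_cancel, hw, toFun_approx hQ ha f (w' - w), ← hw, Complex.re_ofReal_mul] at h1
  have h2 : ‖(w' : Lp ℂ 2 μ) - f‖ ≤ ‖(w : Lp ℂ 2 μ) - f‖ := by
    have := hC.norm_compLp_sub_le h0 (w : Lp ℂ 2 μ) f
    rwa [hf, NNReal.coe_one, one_mul] at this
  have h3 : ‖(w' : Lp ℂ 2 μ) - f‖ ^ 2 = ‖(w : Lp ℂ 2 μ) - f‖ ^ 2 -
      2 * (inner ℂ ((w' - w : Q.domain) : Lp ℂ 2 μ) (f - w)).re +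
      ‖((w' - w : Q.domain) : Lp ℂ 2 μ)‖ ^ 2 := by
    have e : (w' : Lp ℂ 2 μ) - f = ((w' - w : Q.domain) : Lp ℂ 2 μ) - (f - w) := by simp
    rw [e, @norm_sub_sq ℂ, norm_sub_rev f]
    simp only [RCLike.re_to_complex]
    ring
  have h4 := (hQ.1 (w' - w)).1
  have h5 := pow_le_pow_left₀ (norm_nonneg _) h2 2
  have h6 : ‖((w' - w : Q.domain) : Lp ℂ 2 μ)‖ ^ 2 ≤ 0 := by
    have h7 : (inner ℂ ((w' - w : Q.domain) : Lp ℂ 2 μ) (f - Q.approx hQ a ha f)).re =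
      (inner ℂ ((w' - w : Q.domain) : Lp ℂ 2 μ) (f - w)).re := rfl
    rw [h7] at h1
    by_contra hlt
    nlinarith [mul_pos ha (not_le.1 hlt)]
  have h8 : ((w' - w : Q.domain) : Lp ℂ 2 μ) = 0 := by
    rw [← norm_eq_zero]
    exact pow_eq_zero_iff two_ne_zero |>.1 (le_antisymm h6 (sq_nonneg _))
  exact sub_eq_zero.1 h8

end SesqForm

namespace WeightedGraph

/-! ### The formal Laplacian on locally finite graphs -/

section FormalLaplacian

variable {V : Type*} {G : WeightedGraph V}

theorem m_ne_zero (G : WeightedGraph V) (x : V) : (G.m x : ℂ) ≠ 0 := Complex.ofReal_ne_zero.2 (G.m_pos x).ne'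

theorem b_eq_zero_of_notMem (hG : G.LocallyFinite) {x y : V} (h : y ∉ (hG x).toFinset) :
    G.b x y = 0 := by
  rw [Set.Finite.mem_toFinset] at h
  exact le_antisymm (not_lt.1 h) (G.b_nonneg x y)

theorem tsum_b_eq_sum (hG : G.LocallyFinite) (x : V) (f : V → ℂ) :
    ∑' y, (G.b x y : ℂ) * f y = ∑ y ∈ (hG x).toFinset, (G.b x y : ℂ) * f y :=
  tsum_eq_sum fun y hy => by rw [b_eq_zero_of_notMem hG hy, Complex.ofReal_zero, zero_mul]

theorem m_mul_formalLaplacian (hG : G.LocallyFinite) (u : V → ℂ) (x : V) :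
    (G.m x : ℂ) * G.formalLaplacian u x =
      ∑ y ∈ (hG x).toFinset, (G.b x y : ℂ) * (u x - u y) + G.c x * u x := by
  have := G.m_ne_zero x
  rw [formalLaplacian, tsum_b_eq_sum hG]
  field_simp

theorem mem_formalDomain (hG : G.LocallyFinite) (u : V → ℂ) : u ∈ G.formalDomain := by
  intro x
  refine summable_of_hasFiniteSupport ((hG x).subset fun y hy => ?_)
  by_contra h
  refine hy ?_
  simp [b_eq_zero_of_notMem hG (x := x) (y := y) (by simpa using h)]

end FormalLaplacian

/-! ### Point masses in `ℓ²(V, m)` -/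

variable {V : Type*} [MeasurableSpace V]

theorem ell2_ext (G : WeightedGraph V) {u v : G.ell2} (h : ∀ x, u x = v x) : u = v :=
  Lp.ext (ae_of_all _ h)

variable [DiscreteMeasurableSpace V] (G : WeightedGraph V)

theorem coe_sum {ι : Type*} (s : Finset ι) (f : ι → G.ell2) (x : V) :
    (∑ i ∈ s, f i : G.ell2) x = ∑ i ∈ s, f i x := by
  classical
  induction s using Finset.induction_on with
  | empty => rw [Finset.sum_empty, Finset.sum_empty, coe_zero]
  | insert i s hi ih => rw [Finset.sum_insert hi, Finset.sum_insert hi, coe_add, ih]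

theorem compLp_apply {C : ℂ → ℂ} (hC : LipschitzWith 1 C) (h0 : C 0 = 0) (u : G.ell2) (x : V) :
    (hC.compLp h0 u : G.ell2) x = C (u x) :=
  G.forall_of_ae (hC.coeFn_compLp h0 u) x

theorem measure_singleton (x : V) : G.measure {x} = ENNReal.ofReal (G.m x) := by
  rw [measure, Measure.sum_apply _ (MeasurableSet.singleton x), tsum_eq_single x]
  · simp
  · intro y hy
    simp [hy]

theorem measure_singleton_ne_top (x : V) : G.measure {x} ≠ ⊤ := by
  rw [measure_singleton]; exact ENNReal.ofReal_ne_top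

/-- The indicator function of the vertex `x`, as an element of `ℓ²(V, m)`. -/
noncomputable def single (x : V) : G.ell2 :=
  indicatorConstLp 2 (MeasurableSet.singleton x) (G.measure_singleton_ne_top x) (1 : ℂ)

theorem single_apply (x y : V) : G.single x y = ({x} : Set V).indicator (fun _ => (1 : ℂ)) y :=
  G.forall_of_ae indicatorConstLp_coeFn y

theorem single_self (x : V) : G.single x x = 1 := by simp [single_apply]

theorem single_of_ne {x y : V} (h : y ≠ x) : G.single x y = 0 := by simp [single_apply, h]

theorem inner_single (x : V) (u : G.ell2) : inner ℂ (G.single x) u = G.m x * u x := by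
  rw [single, L2.inner_indicatorConstLp_one, integral_singleton, Measure.real, measure_singleton,
    ENNReal.toReal_ofReal (G.m_pos x).le, Complex.real_smul]

theorem inner_single_right (x : V) (u : G.ell2) :
    inner ℂ u (G.single x) = G.m x * conj (u x) := by
  rw [← inner_conj_symm, inner_single, map_mul, Complex.conj_ofReal]

theorem single_mem_finSupp (x : V) : G.single x ∈ G.finSupp :=
  (Set.finite_singleton x).subset fun y hy => by
    by_contra h
    exact hy (G.single_of_ne h)

theorem dense_finSupp : Dense (G.finSupp : Set G.ell2) := by
  rw [Submodule.dense_iff_topologicalClosure_eq_top, Submodule.topologicalClosure_eq_top_iff,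
    Submodule.eq_bot_iff]
  intro u hu
  refine G.ell2_ext fun x => ?_
  have h := (Submodule.mem_orthogonal _ _).1 hu _ (G.single_mem_finSupp x)
  rw [inner_single] at h
  rw [coe_zero]
  exact (mul_eq_zero.1 h).resolve_left (G.m_ne_zero x)

theorem eq_sum_single {u : G.ell2} {W : Finset V} (h : ∀ x, x ∉ W → u x = 0) :
    u = ∑ x ∈ W, u x • G.single x := by
  refine G.ell2_ext fun y => ?_
  rw [coe_sum]
  simp only [coe_smul]
  by_cases hy : y ∈ W
  · rw [Finset.sum_eq_single_of_mem y hy, single_self, mul_one]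
    intro x _ hx
    rw [G.single_of_ne hx.symm, mul_zero]
  · rw [h y hy, Finset.sum_eq_zero]
    intro x hx
    rw [G.single_of_ne (ne_of_mem_of_not_mem hx hy).symm, mul_zero]

theorem exists_finset_of_mem_finSupp {u : G.ell2} (hu : u ∈ G.finSupp) :
    ∃ W : Finset V, ∀ x, x ∉ W → u x = 0 := by
  have hu' : (Function.support (u : V → ℂ)).Finite := hu
  exact ⟨hu'.toFinset, fun x hx => by simpa using hx⟩

/-! ### Green's formula -/

variable {G}

theorem hasFiniteEnergy_single (x : V) : G.HasFiniteEnergy (G.single x) :=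
  G.finSupp_le (G.single_mem_finSupp x)

/-- Green's formula for a point mass. -/
theorem energy_single (hG : G.LocallyFinite) (u : G.ell2) (x : V) :
    G.energy u (G.single x) = G.m x * G.formalLaplacian u x := by
  set F : V × V → ℂ := fun p => (G.b p.1 p.2 : ℂ) * G.diff u p * conj (G.single x p.1) with hF
  have h1 : HasSum F (∑ y ∈ (hG x).toFinset, (G.b x y : ℂ) * (u x - u y)) := by
    have h : HasSum F (∑ p ∈ {x} ×ˢ (hG x).toFinset, F p) := hasSum_sum_of_ne_finset_zero (by
      rintro ⟨z, y⟩ hzy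
      by_cases hz : z = x
      · subst hz
        simp only [Finset.mem_product, Finset.mem_singleton, true_and] at hzy
        simp [hF, b_eq_zero_of_notMem hG hzy]
      · simp [hF, G.single_of_ne hz])
    rw [Finset.sum_product, Finset.sum_singleton] at h
    simpa [hF, single_self, diff] using h
  have h2 : HasSum (fun p => F p + (F ∘ Equiv.prodComm V V) p) _ :=
    h1.add ((Equiv.prodComm V V).hasSum_iff.2 h1)
  have h3 : (fun p : V × V => (G.b p.1 p.2 : ℂ) * G.diff u p * conj (G.diff (G.single x) p)) =
      fun p => F p + (F ∘ Equiv.prodComm V V) p := by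
    funext p
    simp only [hF, Function.comp, Equiv.prodComm_apply, Prod.swap, diff, map_sub, G.b_symm p.2 p.1]
    ring
  rw [energy, h3, h2.tsum_eq, m_mul_formalLaplacian hG, tsum_eq_single x]
  · rw [single_self, map_one, mul_one]; ring
  · intro y hy
    rw [G.single_of_ne hy, map_zero, mul_zero]

/-- The functional `v ↦ m(x) L̃v(x)` is continuous on `ℓ²(V, m)`; the representing vector is
`L̃ 1ₓ`. -/
theorem exists_inner_eq_formalLaplacian (hG : G.LocallyFinite) (x : V) :
    ∃ g : G.ell2, ∀ v : G.ell2, inner ℂ v g = conj (G.m x * G.formalLaplacian v x) := by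
  refine ⟨∑ y ∈ (hG x).toFinset, ((G.b x y / G.m x : ℂ) • G.single x -
    (G.b x y / G.m y : ℂ) • G.single y) + (G.c x / G.m x : ℂ) • G.single x, fun v => ?_⟩
  rw [m_mul_formalLaplacian hG, inner_add_right, inner_sum, map_add, map_sum]
  congr 1
  · refine Finset.sum_congr rfl fun y _ => ?_
    have hx := G.m_ne_zero x
    have hy := G.m_ne_zero y
    simp only [inner_sub_right, inner_smul_right, inner_single_right, map_mul, map_sub,
      Complex.conj_ofReal]
    field_simp
  · have hx := G.m_ne_zero x
    simp only [inner_smul_right, inner_single_right, map_mul, Complex.conj_ofReal]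
    field_simp

/-! ### The Neumann and the Dirichlet form are Dirichlet forms -/

theorem hasFiniteEnergy_compLp {C : ℂ → ℂ} (hC : LipschitzWith 1 C) (h0 : C 0 = 0) {u : G.ell2}
    (hu : G.HasFiniteEnergy u) : G.HasFiniteEnergy (hC.compLp h0 u) ∧
      (G.energy (hC.compLp h0 u) (hC.compLp h0 u)).re ≤ (G.energy u u).re := by
  have hb : ∀ p : V × V, G.b p.1 p.2 * ‖G.diff (hC.compLp h0 u) p‖ ^ 2 ≤
      G.b p.1 p.2 * ‖G.diff u p‖ ^ 2 := fun p => by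
    have h := hC.norm_sub_le (u p.1) (u p.2)
    rw [NNReal.coe_one, one_mul] at h
    rw [diff, compLp_apply, compLp_apply]
    exact mul_le_mul_of_nonneg_left (pow_le_pow_left₀ (norm_nonneg _) h 2) (G.b_nonneg _ _)
  have hc : ∀ x, G.c x * ‖(hC.compLp h0 u : G.ell2) x‖ ^ 2 ≤ G.c x * ‖u x‖ ^ 2 := fun x => by
    have h := hC.norm_sub_le (u x) 0
    rw [NNReal.coe_one, one_mul, h0, sub_zero, sub_zero] at h
    rw [compLp_apply]
    exact mul_le_mul_of_nonneg_left (pow_le_pow_left₀ (norm_nonneg _) h 2) (G.c_nonneg _)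
  have h : G.HasFiniteEnergy (hC.compLp h0 u) :=
    ⟨hu.1.of_nonneg_of_le (fun p => mul_nonneg (G.b_nonneg _ _) (sq_nonneg _)) hb,
      hu.2.of_nonneg_of_le (fun x => mul_nonneg (G.c_nonneg _) (sq_nonneg _)) hc⟩
  refine ⟨h, ?_⟩
  rw [energy_self, energy_self, Complex.ofReal_re, Complex.ofReal_re]
  exact add_le_add (mul_le_mul_of_nonneg_left (h.1.tsum_le_tsum hb hu.1) (by norm_num))
    (h.2.tsum_le_tsum hc hu.2)

theorem neumannForm_isDirichletForm : G.neumannForm.IsDirichletForm :=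
  ⟨G.neumannForm_isClosed, fun _ hC h0 u =>
    ⟨(hasFiniteEnergy_compLp hC h0 u.2).1, (hasFiniteEnergy_compLp hC h0 u.2).2⟩⟩

/-- If `uₙ → u` in the form norm with `uₙ` finitely supported, then the `C uₙ` are finitely
supported, bounded in the form norm and converge to `C u` in `ℓ²`, so that `C u` is in the form
norm closure as well. -/
theorem dirichletForm_isDirichletForm : G.dirichletForm.IsDirichletForm := by
  refine ⟨G.dirichletForm_isClosureOf.1, fun C hC h0 u => ?_⟩
  obtain ⟨u, hu, happ⟩ := u
  obtain ⟨hCu, hle⟩ := hasFiniteEnergy_compLp hC h0 hu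
  refine ⟨?_, hle⟩
  set u' : G.neumannForm.domain := ⟨u, hu⟩
  choose v hv hlt using fun n : ℕ => happ (1 / ((n : ℝ) + 1)) (by positivity)
  have hlim : Tendsto (fun n => G.neumannForm.normSq (v n - u')) atTop (𝓝 0) := by
    refine squeeze_zero (fun n => SesqForm.normSq_nonneg G.neumannForm_isNonneg _) (fun n => ?_)
      tendsto_one_div_add_atTop_nhds_zero_nat
    rw [SesqForm.normSq_sub_comm]
    exact (hlt n).le
  have hL2 := G.neumannForm.tendsto_coe G.neumannForm_isNonneg hlim
  refine SesqForm.mem_formClosure_of_tendsto G.neumannForm_isClosed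
    (u := fun n => ⟨hC.compLp h0 (v n : G.ell2), (hasFiniteEnergy_compLp hC h0 (v n).2).1⟩)
    (w := ⟨_, hCu⟩) (M := 2 * 1 + 2 * G.neumannForm.normSq u') (fun n => ?_) (fun n => ?_)
    (((hC.lipschitzWith_compLp h0).continuous.tendsto u).comp hL2)
  · refine Set.Finite.subset (hv n) fun x hx h => hx ?_
    change (hC.compLp h0 (v n : G.ell2) : G.ell2) x = 0
    rw [compLp_apply, h, h0]
  · have h1 : G.neumannForm.normSq ⟨hC.compLp h0 (v n : G.ell2),
        (hasFiniteEnergy_compLp hC h0 (v n).2).1⟩ ≤ G.neumannForm.normSq (v n) := by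
      refine add_le_add (hasFiniteEnergy_compLp hC h0 (v n).2).2
        (pow_le_pow_left₀ (norm_nonneg _) ?_ 2)
      simpa using hC.norm_compLp_le h0 (v n : G.ell2)
    have h2 := SesqForm.normSq_add_le G.neumannForm_isNonneg (v n - u') u'
    rw [sub_add_cancel] at h2
    have h3 : G.neumannForm.normSq (v n - u') ≤ 1 := by
      rw [SesqForm.normSq_sub_comm]
      refine (hlt n).le.trans ?_
      rw [div_le_one (by positivity)]
      exact le_add_of_nonneg_left n.cast_nonneg
    linarith

/-! ### Existence of the Neumann and the Dirichlet Laplacian -/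

/-- A Dirichlet form between `Q^comp` and `Q^(N)` is the form of a Markovian restriction of the
formal Laplacian. -/
theorem exists_isMarkovianRestriction (hG : G.LocallyFinite) {Q : SesqForm G.ell2}
    (hQ : Q.IsDirichletForm) (hfin : G.finSupp ≤ Q.domain) (hN : Q.IsExtendedBy G.neumannForm) :
    ∃ L : G.ell2 →ₗ.[ℂ] G.ell2, G.IsMarkovianRestriction L ∧ Q.IsAssociatedTo L := by
  obtain ⟨L, hsa, hnn, hL⟩ := SesqForm.exists_isAssociatedTo hQ.1 (G.dense_finSupp.mono hfin)
  refine ⟨L, ⟨hsa, hnn, fun u => ⟨mem_formalDomain hG _, fun x => ?_⟩, Q, hL, hQ⟩, hL⟩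
  obtain ⟨hu, h⟩ := hL.mem_graph_iff.1 (L.mem_graph u)
  have h1 := h ⟨_, hfin (G.single_mem_finSupp x)⟩
  rw [hN.2, inner_single] at h1
  exact mul_left_cancel₀ (G.m_ne_zero x) (h1.symm.trans (energy_single hG _ x))

/-! ### Markovian restrictions lie below the Dirichlet Laplacian -/

/-- By Green's formula `1ₓ` is in the domain of the adjoint of every restriction `L` of the formal
Laplacian, hence in the domain of `L` if `L` is self-adjoint. -/
theorem single_mem_domain (hG : G.LocallyFinite) {L : G.ell2 →ₗ.[ℂ] G.ell2}
    (hsa : IsSelfAdjoint L) (hL : G.IsRestrictionOfFormal L) {Q : SesqForm G.ell2}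
    (hQ : Q.IsAssociatedTo L) (x : V) : ∃ h : G.single x ∈ Q.domain, ∀ v : Q.domain,
      Q.toFun ⟨_, h⟩ v = conj (G.m x * G.formalLaplacian (v : G.ell2) x) := by
  obtain ⟨g, hg⟩ := exists_inner_eq_formalLaplacian hG x
  have h : (G.single x, g) ∈ L.graph := by
    rw [SesqForm.mem_graph_iff_of_isSelfAdjoint hsa]
    intro v
    rw [hg, inner_single_right, (hL v).2, map_mul, Complex.conj_ofReal]
  obtain ⟨h1, h2⟩ := hQ.mem_graph_iff.1 h
  exact ⟨h1, fun v => (h2 v).trans (hg v)⟩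

theorem compForm_isExtendedBy (hG : G.LocallyFinite) {L : G.ell2 →ₗ.[ℂ] G.ell2}
    (hsa : IsSelfAdjoint L) (hL : G.IsRestrictionOfFormal L) {Q : SesqForm G.ell2}
    (hQ : Q.IsAssociatedTo L) : G.compForm.IsExtendedBy Q := by
  have key : ∀ u ∈ G.finSupp, ∃ h : u ∈ Q.domain, ∀ v : Q.domain, G.HasFiniteEnergy v →
      Q.toFun ⟨u, h⟩ v = G.energy u v := by
    intro u hu
    obtain ⟨W, hW⟩ := G.exists_finset_of_mem_finSupp hu
    choose hs hsv using single_mem_domain hG hsa hL hQ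
    have hu' : u ∈ Q.domain := by
      rw [G.eq_sum_single hW]
      exact Q.domain.sum_mem fun x _ => Q.domain.smul_mem _ (hs x)
    have e : (⟨u, hu'⟩ : Q.domain) =
        ∑ x ∈ W, u x • ⟨_, hs x⟩ := Subtype.ext (by
      rw [AddSubmonoidClass.coe_finsetSum]; exact G.eq_sum_single hW)
    have e' : (⟨u, G.finSupp_le hu⟩ : G.neumannForm.domain) =
        ∑ x ∈ W, u x • ⟨_, hasFiniteEnergy_single x⟩ := Subtype.ext (by
      rw [AddSubmonoidClass.coe_finsetSum]; exact G.eq_sum_single hW)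
    refine ⟨hu', fun v hv => ?_⟩
    have hN : G.energy u v = G.neumannForm.toFun ⟨u, G.finSupp_le hu⟩ ⟨v, hv⟩ := rfl
    rw [hN, e, e', map_sum, map_sum, LinearMap.sum_apply, LinearMap.sum_apply]
    refine Finset.sum_congr rfl fun x _ => ?_
    rw [map_smul, map_smul, LinearMap.smul_apply, LinearMap.smul_apply, hsv x v,
      ← energy_single hG, energy_conj_symm]
    rfl
  exact ⟨fun u hu => (key u hu).1, fun u v =>
    ((key u u.2).2 ⟨v, (key v v.2).1⟩ (G.finSupp_le v.2)).symm⟩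

theorem formLE_dirichletForm (hG : G.LocallyFinite) {L : G.ell2 →ₗ.[ℂ] G.ell2}
    (hsa : IsSelfAdjoint L) (hL : G.IsRestrictionOfFormal L) {Q : SesqForm G.ell2}
    (hQ : Q.IsAssociatedTo L) : Q.FormLE G.dirichletForm := by
  obtain ⟨h, h'⟩ := G.dirichletForm_isClosureOf.2.2 Q hQ.isClosed
    (compForm_isExtendedBy hG hsa hL hQ)
  exact ⟨h, fun u => (congrArg Complex.re (h' u u)).ge⟩

end WeightedGraph

/-! ### Symmetric sub-Markovian operators -/

namespace WeightedGraph

variable {V : Type*} [MeasurableSpace V] [DiscreteMeasurableSpace V] {G : WeightedGraph V}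

/-- The matrix `⟨1ₓ, P 1_y⟩` of an operator on `ℓ²(V, m)`; only its real part is recorded, as the
entries are real for the operators of interest. -/
noncomputable def kernel (G : WeightedGraph V) (P : G.ell2 →L[ℂ] G.ell2) (x y : V) : ℝ :=
  (inner ℂ (G.single x) (P (G.single y))).re

/-- Symmetric operators on `ℓ²(V, m)` with `0 ≤ P f ≤ 1` whenever `f` is the indicator function of
a finite set. -/
structure IsSymmSubMarkov (G : WeightedGraph V) (P : G.ell2 →L[ℂ] G.ell2) : Prop where
  symm : ∀ f g, inner ℂ (P f) g = inner ℂ f (P g)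
  markov : ∀ (W : Finset V) (x : V), ∃ t : ℝ, 0 ≤ t ∧ t ≤ 1 ∧ P (∑ y ∈ W, G.single y) x = t

namespace IsSymmSubMarkov

variable {P : G.ell2 →L[ℂ] G.ell2} (hP : G.IsSymmSubMarkov P)
include hP

theorem exists_apply_single (x y : V) : ∃ t : ℝ, 0 ≤ t ∧ P (G.single y) x = t := by
  obtain ⟨t, h0, -, h⟩ := hP.markov {y} x
  exact ⟨t, h0, by simpa using h⟩

theorem kernel_nonneg (x y : V) : 0 ≤ G.kernel P x y := by
  obtain ⟨t, h0, h⟩ := hP.exists_apply_single x y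
  rw [kernel, inner_single, h, ← Complex.ofReal_mul, Complex.ofReal_re]
  exact mul_nonneg (G.m_pos x).le h0

theorem inner_single_apply (x y : V) :
    inner ℂ (G.single x) (P (G.single y)) = (G.kernel P x y : ℂ) := by
  obtain ⟨t, -, h⟩ := hP.exists_apply_single x y
  rw [kernel, inner_single, h, ← Complex.ofReal_mul, Complex.ofReal_re]

theorem kernel_symm (x y : V) : G.kernel P x y = G.kernel P y x := by
  rw [kernel, ← hP.symm, ← inner_conj_symm, Complex.conj_re, ← kernel]

theorem sum_kernel (x : V) (W : Finset V) :
    ((∑ y ∈ W, G.kernel P x y : ℝ) : ℂ) = G.m x * P (∑ y ∈ W, G.single y) x := by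
  rw [← inner_single, map_sum, inner_sum, Complex.ofReal_sum]
  exact Finset.sum_congr rfl fun y _ => (hP.inner_single_apply x y).symm

theorem sum_kernel_le (x : V) (W : Finset V) : ∑ y ∈ W, G.kernel P x y ≤ G.m x := by
  obtain ⟨t, -, h1, h⟩ := hP.markov W x
  have e := hP.sum_kernel x W
  rw [h, ← Complex.ofReal_mul, Complex.ofReal_inj] at e
  rw [e]
  exact mul_le_of_le_one_right (G.m_pos x).le h1

theorem summable_kernel (x : V) : Summable (G.kernel P x) :=
  summable_of_sum_le (hP.kernel_nonneg x) (hP.sum_kernel_le x)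

theorem tsum_kernel_le (x : V) : ∑' y, G.kernel P x y ≤ G.m x :=
  (hP.summable_kernel x).tsum_le_of_sum_le (hP.sum_kernel_le x)

/-- For finitely supported `u`, the form `⟨u, u - P u⟩` has a representation as the energy of a
graph with edge weights `⟨1ₓ, P 1_y⟩`. -/
theorem re_inner_eq_of_finset {u : G.ell2} {W : Finset V} (hW : ∀ x, x ∉ W → u x = 0) :
    (inner ℂ u (u - P u)).re =
      1 / 2 * ∑ x ∈ W, ∑ y ∈ W, G.kernel P x y * ‖u x - u y‖ ^ 2 +
        ∑ x ∈ W, (G.m x - ∑ y ∈ W, G.kernel P x y) * ‖u x‖ ^ 2 := by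
  have h1 : inner ℂ u u = ∑ x ∈ W, (G.m x : ℂ) * (conj (u x) * u x) := by
    conv_lhs => arg 2; rw [G.eq_sum_single hW]
    rw [sum_inner]
    refine Finset.sum_congr rfl fun x _ => ?_
    rw [inner_smul_left, inner_single]; ring
  have h2 : inner ℂ u (P u) =
      ∑ x ∈ W, ∑ y ∈ W, (G.kernel P x y : ℂ) * (conj (u x) * u y) := by
    conv_lhs => rw [G.eq_sum_single hW, map_sum, sum_inner]
    refine Finset.sum_congr rfl fun x _ => ?_
    rw [inner_sum]
    refine Finset.sum_congr rfl fun y _ => ?_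
    rw [map_smul, inner_smul_left, inner_smul_right, hP.inner_single_apply]; ring
  have h3 : ∀ a b : ℂ, (conj a * b).re = 1 / 2 * (‖a‖ ^ 2 + ‖b‖ ^ 2 - ‖a - b‖ ^ 2) := by
    intro a b
    simp only [← Complex.normSq_eq_norm_sq, Complex.normSq_apply, Complex.mul_re, Complex.conj_re,
      Complex.conj_im, Complex.sub_re, Complex.sub_im]
    ring
  have h4 : ∑ x ∈ W, ∑ y ∈ W, G.kernel P x y * ‖u y‖ ^ 2 =
      ∑ x ∈ W, ∑ y ∈ W, G.kernel P x y * ‖u x‖ ^ 2 := by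
    rw [Finset.sum_comm]
    exact Finset.sum_congr rfl fun x _ => Finset.sum_congr rfl fun y _ => by
      rw [hP.kernel_symm]
  rw [inner_sub_right, h1, h2, Complex.sub_re, Complex.re_sum, Complex.re_sum]
  simp only [Complex.re_sum, Complex.re_ofReal_mul, h3, sub_self, norm_zero, sub_mul,
    Finset.sum_mul, Finset.sum_sub_distrib, mul_sub, mul_add, Finset.sum_add_distrib]
  simp only [mul_left_comm _ (1 / 2 : ℝ), ← Finset.mul_sum, h4]
  norm_num
  ring

theorem sum_le_re_inner_of_mem_finSupp {u : G.ell2} (hu : u ∈ G.finSupp) (F : Finset V) :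
    1 / 2 * ∑ x ∈ F, ∑ y ∈ F, G.kernel P x y * ‖u x - u y‖ ^ 2 +
      ∑ x ∈ F, (G.m x - ∑' y, G.kernel P x y) * ‖u x‖ ^ 2 ≤ (inner ℂ u (u - P u)).re := by
  classical
  obtain ⟨W₀, hW₀⟩ := G.exists_finset_of_mem_finSupp hu
  set W := W₀ ∪ F
  have hFW : F ⊆ W := Finset.subset_union_right
  rw [hP.re_inner_eq_of_finset (W := W) fun x hx =>
    hW₀ x fun h => hx (Finset.mem_union_left _ h)]
  have h0 : ∀ x y, 0 ≤ G.kernel P x y * ‖u x - u y‖ ^ 2 := fun x y =>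
    mul_nonneg (hP.kernel_nonneg x y) (sq_nonneg _)
  refine add_le_add (mul_le_mul_of_nonneg_left ?_ (by norm_num)) ?_
  · calc _ ≤ ∑ x ∈ F, ∑ y ∈ W, G.kernel P x y * ‖u x - u y‖ ^ 2 :=
        Finset.sum_le_sum fun x _ =>
          Finset.sum_le_sum_of_subset_of_nonneg hFW fun y _ _ => h0 x y
      _ ≤ _ := Finset.sum_le_sum_of_subset_of_nonneg hFW fun x _ _ =>
          Finset.sum_nonneg fun y _ => h0 x y
  · calc _ ≤ ∑ x ∈ F, (G.m x - ∑ y ∈ W, G.kernel P x y) * ‖u x‖ ^ 2 :=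
        Finset.sum_le_sum fun x _ => mul_le_mul_of_nonneg_right
          (sub_le_sub_left ((hP.summable_kernel x).sum_le_tsum W
            fun y _ => hP.kernel_nonneg x y) _) (sq_nonneg _)
      _ ≤ _ := Finset.sum_le_sum_of_subset_of_nonneg hFW fun x _ _ =>
          mul_nonneg (sub_nonneg.2 (hP.sum_kernel_le x W)) (sq_nonneg _)

end IsSymmSubMarkov

theorem continuous_eval (G : WeightedGraph V) (x : V) : Continuous fun u : G.ell2 => u x := by
  have h : (fun u : G.ell2 => u x) = fun u => (G.m x : ℂ)⁻¹ * inner ℂ (G.single x) u := by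
    funext u
    rw [inner_single, inv_mul_cancel_left₀ (G.m_ne_zero x)]
  rw [h]
  exact continuous_const.mul (continuous_const.inner continuous_id)

/-- The form `⟨u, u - P u⟩` dominates every finite part of the energy of the graph with edge weights
`⟨1ₓ, P 1_y⟩` and killing term `m(x) - ∑ ⟨1ₓ, P 1_y⟩`. -/
theorem IsSymmSubMarkov.sum_le_re_inner {P : G.ell2 →L[ℂ] G.ell2} (hP : G.IsSymmSubMarkov P)
    (u : G.ell2) (F : Finset V) :
    1 / 2 * ∑ x ∈ F, ∑ y ∈ F, G.kernel P x y * ‖u x - u y‖ ^ 2 +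
      ∑ x ∈ F, (G.m x - ∑' y, G.kernel P x y) * ‖u x‖ ^ 2 ≤ (inner ℂ u (u - P u)).re := by
  have hc := G.continuous_eval
  refine G.dense_finSupp.induction (fun u hu => hP.sum_le_re_inner_of_mem_finSupp hu F)
    (isClosed_le ?_ ?_) u
  · fun_prop
  · fun_prop

/-! ### The approximating forms of a Dirichlet form -/

theorem isSymmSubMarkov_approx {Q : SesqForm G.ell2} (hQ : Q.IsClosed) (hD : Q.IsDirichletForm)
    {a : ℝ} (ha : 0 < a) : G.IsSymmSubMarkov (Q.approx hQ a ha) := by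
  refine ⟨SesqForm.inner_approx_left hQ ha, fun W x => ?_⟩
  -- the projection of `ℂ` onto `[0,1]` is a normal contraction that fixes indicator functions
  set C : ℂ → ℂ := fun z => ((max 0 (min 1 z.re) : ℝ) : ℂ) with hCdef
  have hC : LipschitzWith 1 C := LipschitzWith.of_dist_le_mul fun z w => by
    rw [NNReal.coe_one, one_mul, dist_eq_norm, dist_eq_norm, ← Complex.ofReal_sub,
      Complex.norm_real, Real.norm_eq_abs]
    have h1 := abs_max_sub_max_le_max 0 (min 1 z.re) 0 (min 1 w.re)
    have h2 := abs_min_sub_min_le_max 1 z.re 1 w.re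
    have h3 := Complex.abs_re_le_norm (z - w)
    rw [Complex.sub_re] at h3
    simp only [sub_self, abs_zero] at h1 h2
    have h4 := abs_nonneg (z.re - w.re)
    rw [max_eq_right (abs_nonneg (min 1 z.re - min 1 w.re))] at h1
    rw [max_eq_right h4] at h2
    exact h1.trans (h2.trans h3)
  have h0 : C 0 = 0 := by simp [hCdef]
  have hf : hC.compLp h0 (∑ y ∈ W, G.single y : G.ell2) = ∑ y ∈ W, G.single y := by
    refine G.ell2_ext fun x => ?_
    rw [compLp_apply, coe_sum]
    by_cases hx : x ∈ W
    · rw [Finset.sum_eq_single_of_mem x hx fun y _ hy => G.single_of_ne hy.symm, single_self]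
      simp [hCdef]
    · rw [Finset.sum_eq_zero fun y hy => G.single_of_ne (ne_of_mem_of_not_mem hy hx).symm, h0]
  have h := hD.compLp_approx hQ ha hC h0 hf
  refine ⟨max 0 (min 1 (Q.approx hQ a ha (∑ y ∈ W, G.single y) x).re), le_max_left _ _,
    max_le zero_le_one (min_le_left _ _), ?_⟩
  conv_lhs => rw [← h]
  rw [compLp_apply]

section Limits

variable {Q : SesqForm G.ell2} (hQ : Q.IsClosed) (hG : G.LocallyFinite)
  (hs : ∀ x, ∃ h : G.single x ∈ Q.domain, ∀ v : Q.domain,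
    Q.toFun ⟨_, h⟩ v = conj (G.m x * G.formalLaplacian (v : G.ell2) x))
include hs

/-- `L̃ P f = a (f - P f)` for `P = a (L + a)⁻¹`. -/
theorem m_mul_formalLaplacian_approx {a : ℝ} (ha : 0 < a) (f : G.ell2) (x : V) :
    G.m x * G.formalLaplacian (Q.approx hQ a ha f) x =
      a * (G.m x * (f x - Q.approx hQ a ha f x)) := by
  obtain ⟨h, hv⟩ := hs x
  have h1 := SesqForm.toFun_approx hQ ha f ⟨_, h⟩
  rw [hQ.2.1, hv, Complex.conj_conj, inner_single, coe_sub] at h1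
  exact h1

include hG

/-- Off the diagonal, the edge weights of the approximating forms converge to those of the
graph. -/
theorem tendsto_mul_kernel {x y : V} (hxy : x ≠ y) :
    Tendsto (fun n : ℕ => ((n : ℝ) + 1) *
      G.kernel (Q.approx hQ ((n : ℝ) + 1) n.cast_add_one_pos) x y) atTop (𝓝 (G.b x y)) := by
  set P := fun n : ℕ => Q.approx hQ ((n : ℝ) + 1) n.cast_add_one_pos
  have hev : ∀ z, Tendsto (fun n => P n (G.single y) z) atTop (𝓝 (G.single y z)) := fun z =>
    ((G.continuous_eval z).tendsto _).comp
      (SesqForm.tendsto_approx hQ ⟨_, (hs y).1⟩)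
  have h1 : ∀ n : ℕ, ((n : ℝ) + 1) * G.kernel (P n) x y = (-(∑ z ∈ (hG x).toFinset,
      (G.b x z : ℂ) * (P n (G.single y) x - P n (G.single y) z) +
        G.c x * P n (G.single y) x)).re := by
    intro n
    rw [← m_mul_formalLaplacian hG, m_mul_formalLaplacian_approx hQ hs, G.single_of_ne hxy,
      zero_sub, kernel, inner_single, ← Complex.re_ofReal_mul]
    congr 1
    ring
  have h2 : (-(∑ z ∈ (hG x).toFinset, (G.b x z : ℂ) * (G.single y x - G.single y z) +
      G.c x * G.single y x)).re = G.b x y := by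
    rw [G.single_of_ne hxy, mul_zero, add_zero]
    by_cases hy : y ∈ (hG x).toFinset
    · rw [Finset.sum_eq_single_of_mem y hy fun z _ hz => by rw [G.single_of_ne hz]; simp,
        single_self]
      simp
    · rw [Finset.sum_eq_zero fun z hz => by
        rw [G.single_of_ne (ne_of_mem_of_not_mem hz hy)]; simp, b_eq_zero_of_notMem hG hy]
      simp
  rw [← h2]
  refine Tendsto.congr (fun n => (h1 n).symm) ?_
  refine (Complex.continuous_re.tendsto _).comp ((Tendsto.add ?_ ?_).neg)
  · exact tendsto_finsetSum _ fun z _ => ((hev x).sub (hev z)).const_mul _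
  · exact (hev x).const_mul _

/-- The equation `a (1 - P 1) = L̃ P 1`, where `P 1` is the function `∑ ⟨1ₓ, P 1_y⟩ / m(x)`, obtained
by exhausting `V` by finite sets. -/
theorem mul_sub_tsum_kernel {a : ℝ} (ha : 0 < a) (hP : G.IsSymmSubMarkov (Q.approx hQ a ha))
    (x : V) : a * (G.m x - ∑' y, G.kernel (Q.approx hQ a ha) x y) =
      ∑ z ∈ (hG x).toFinset, G.b x z * ((∑' y, G.kernel (Q.approx hQ a ha) x y) / G.m x -
        (∑' y, G.kernel (Q.approx hQ a ha) z y) / G.m z) +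
      G.c x * ((∑' y, G.kernel (Q.approx hQ a ha) x y) / G.m x) := by
  classical
  set P := Q.approx hQ a ha
  have hlim : ∀ z, Tendsto (fun W : Finset V => ∑ y ∈ W, G.kernel P z y) atTop
      (𝓝 (∑' y, G.kernel P z y)) := fun z => (hP.summable_kernel z).hasSum
  refine tendsto_nhds_unique ((((hlim x).const_sub (G.m x)).const_mul a)) (Tendsto.congr' ?_
    (Tendsto.add (tendsto_finsetSum _ fun z _ =>
      (((hlim x).div_const _).sub ((hlim z).div_const _)).const_mul _)
      (((hlim x).div_const _).const_mul _)))
  filter_upwards [eventually_ge_atTop {x}] with W hW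
  have hxW : x ∈ W := hW (Finset.mem_singleton_self x)
  have e : ∀ z, (((∑ y ∈ W, G.kernel P z y) / G.m z : ℝ) : ℂ) =
      P (∑ y ∈ W, G.single y) z := fun z => by
    rw [Complex.ofReal_div, hP.sum_kernel, mul_div_cancel_left₀ _ (G.m_ne_zero z)]
  have h1 := m_mul_formalLaplacian_approx hQ hs ha (∑ y ∈ W, G.single y) x
  rw [m_mul_formalLaplacian hG, coe_sum,
    Finset.sum_eq_single_of_mem x hxW fun y _ hy => G.single_of_ne hy.symm, single_self,
    mul_sub, mul_one, ← hP.sum_kernel] at h1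
  rw [← Complex.ofReal_inj]
  push_cast
  push_cast at h1 e
  simp only [e]
  exact h1

/-- The killing terms of the approximating forms converge to that of the graph. -/
theorem tendsto_mul_sub_tsum_kernel
    (hP : ∀ n : ℕ, G.IsSymmSubMarkov (Q.approx hQ ((n : ℝ) + 1) n.cast_add_one_pos)) (x : V) :
    Tendsto (fun n : ℕ => ((n : ℝ) + 1) * (G.m x -
      ∑' y, G.kernel (Q.approx hQ ((n : ℝ) + 1) n.cast_add_one_pos) x y)) atTop
      (𝓝 (G.c x)) := by
  set P := fun n : ℕ => Q.approx hQ ((n : ℝ) + 1) n.cast_add_one_pos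
  -- `P 1 → 1` pointwise, since `1 ≥ P 1 ≥ P 1ₓ`
  have hone : ∀ z, Tendsto (fun n => (∑' y, G.kernel (P n) z y) / G.m z) atTop (𝓝 1) := by
    intro z
    have hz := G.m_pos z
    have h1 : Tendsto (fun n => G.kernel (P n) z z / G.m z) atTop (𝓝 1) := by
      have h2 := (SesqForm.tendsto_approx hQ ⟨_, (hs z).1⟩)
      have h3 := ((Complex.continuous_re.tendsto _).comp
        (((continuous_const.inner continuous_id).tendsto _).comp h2 :
          Tendsto (fun n => inner ℂ (G.single z) (P n (G.single z))) atTop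
            (𝓝 (inner ℂ (G.single z) (G.single z))))).div_const (G.m z)
      have h4 : (inner ℂ (G.single z) (G.single z)).re / G.m z = 1 := by
        rw [inner_single, single_self, mul_one, Complex.ofReal_re, div_self hz.ne']
      rw [← h4]
      exact h3
    refine tendsto_of_tendsto_of_tendsto_of_le_of_le h1 tendsto_const_nhds (fun n => ?_)
      (fun n => ?_)
    · exact div_le_div_of_nonneg_right (((hP n).summable_kernel z).le_tsum z
        fun y _ => (hP n).kernel_nonneg z y) hz.le
    · exact (div_le_one hz).2 ((hP n).tsum_kernel_le z)
  have h2 : G.c x = ∑ z ∈ (hG x).toFinset, G.b x z * ((1 : ℝ) - 1) + G.c x * 1 := by simp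
  rw [h2]
  refine Tendsto.congr (fun n => (mul_sub_tsum_kernel hQ hG hs n.cast_add_one_pos (hP n) x).symm) ?_
  exact Tendsto.add (tendsto_finsetSum _ fun z _ => ((hone x).sub (hone z)).const_mul _)
    ((hone x).const_mul _)

end Limits

/-! ### Markovian restrictions lie above the Neumann Laplacian -/

theorem hasFiniteEnergy_of_sum_le {u : G.ell2} {M : ℝ}
    (h : ∀ F : Finset V, 1 / 2 * ∑ x ∈ F, ∑ y ∈ F, G.b x y * ‖u x - u y‖ ^ 2 +
      ∑ x ∈ F, G.c x * ‖u x‖ ^ 2 ≤ M) : G.HasFiniteEnergy u ∧ (G.energy u u).re ≤ M := by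
  classical
  have hb0 : ∀ p : V × V, 0 ≤ G.b p.1 p.2 * ‖G.diff u p‖ ^ 2 := fun p =>
    mul_nonneg (G.b_nonneg _ _) (sq_nonneg _)
  have hc0 : ∀ x, 0 ≤ G.c x * ‖u x‖ ^ 2 := fun x => mul_nonneg (G.c_nonneg _) (sq_nonneg _)
  have key : ∀ (s : Finset (V × V)) (t : Finset V),
      1 / 2 * ∑ p ∈ s, G.b p.1 p.2 * ‖G.diff u p‖ ^ 2 + ∑ x ∈ t, G.c x * ‖u x‖ ^ 2 ≤ M := by
    intro s t
    set F := s.image Prod.fst ∪ s.image Prod.snd ∪ t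
    refine le_trans (add_le_add (mul_le_mul_of_nonneg_left ?_ (by norm_num)) ?_) (h F)
    · rw [← Finset.sum_product' F F fun x y => G.b x y * ‖u x - u y‖ ^ 2]
      refine Finset.sum_le_sum_of_subset_of_nonneg (fun p hp => ?_) fun p _ _ => hb0 p
      simp only [F, Finset.mem_product, Finset.mem_union]
      exact ⟨Or.inl (Or.inl (Finset.mem_image_of_mem _ hp)),
        Or.inl (Or.inr (Finset.mem_image_of_mem _ hp))⟩
    · exact Finset.sum_le_sum_of_subset_of_nonneg Finset.subset_union_right fun x _ _ => hc0 x
  have hfin : G.HasFiniteEnergy u := by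
    refine ⟨summable_of_sum_le (c := 2 * M) hb0 fun s => ?_,
      summable_of_sum_le (c := M) hc0 fun t => ?_⟩
    · have := key s ∅
      rw [Finset.sum_empty] at this
      linarith
    · have := key ∅ t
      rw [Finset.sum_empty] at this
      linarith
  refine ⟨hfin, ?_⟩
  rw [energy_self, Complex.ofReal_re]
  have hA : Tendsto (fun q : Finset (V × V) × Finset V =>
      1 / 2 * ∑ p ∈ q.1, G.b p.1 p.2 * ‖G.diff u p‖ ^ 2 + ∑ x ∈ q.2, G.c x * ‖u x‖ ^ 2)
      (atTop ×ˢ atTop) (𝓝 (1 / 2 * ∑' p : V × V, G.b p.1 p.2 * ‖G.diff u p‖ ^ 2 +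
        ∑' x, G.c x * ‖u x‖ ^ 2)) :=
    ((hfin.1.hasSum.comp tendsto_fst).const_mul _).add (hfin.2.hasSum.comp tendsto_snd)
  exact le_of_tendsto hA (Eventually.of_forall fun q => key q.1 q.2)

theorem neumannForm_formLE (hG : G.LocallyFinite) {L : G.ell2 →ₗ.[ℂ] G.ell2}
    (hsa : IsSelfAdjoint L) (hL : G.IsRestrictionOfFormal L) {Q : SesqForm G.ell2}
    (hQL : Q.IsAssociatedTo L) (hD : Q.IsDirichletForm) : G.neumannForm.FormLE Q := by
  have hQ := hQL.isClosed
  have hs := single_mem_domain hG hsa hL hQL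
  have hP := fun n : ℕ => isSymmSubMarkov_approx hQ hD (a := (n : ℝ) + 1) n.cast_add_one_pos
  have key : ∀ u : Q.domain, G.HasFiniteEnergy (u : G.ell2) ∧
      (G.energy (u : G.ell2) u).re ≤ (Q.toFun u u).re := by
    intro u
    refine hasFiniteEnergy_of_sum_le fun F => ?_
    have h1 : Tendsto (fun n : ℕ => 1 / 2 * ∑ x ∈ F, ∑ y ∈ F, ((n : ℝ) + 1) *
        G.kernel (Q.approx hQ ((n : ℝ) + 1) n.cast_add_one_pos) x y *
          ‖(u : G.ell2) x - (u : G.ell2) y‖ ^ 2 +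
        ∑ x ∈ F, ((n : ℝ) + 1) * (G.m x -
          ∑' y, G.kernel (Q.approx hQ ((n : ℝ) + 1) n.cast_add_one_pos) x y) *
          ‖(u : G.ell2) x‖ ^ 2) atTop
        (𝓝 (1 / 2 * ∑ x ∈ F, ∑ y ∈ F, G.b x y * ‖(u : G.ell2) x - (u : G.ell2) y‖ ^ 2 +
          ∑ x ∈ F, G.c x * ‖(u : G.ell2) x‖ ^ 2)) := by
      refine Tendsto.add (Tendsto.const_mul _ (tendsto_finsetSum _ fun x _ =>
        tendsto_finsetSum _ fun y _ => ?_)) (tendsto_finsetSum _ fun x _ =>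
        (tendsto_mul_sub_tsum_kernel hQ hG hs hP x).mul_const _)
      by_cases hxy : x = y
      · simp [hxy]
      · exact (tendsto_mul_kernel hQ hG hs hxy).mul_const _
    refine le_of_tendsto h1 (Eventually.of_forall fun n => ?_)
    refine le_trans (le_of_eq ?_) ((mul_le_mul_of_nonneg_left ((hP n).sum_le_re_inner u F)
      n.cast_add_one_pos.le).trans (SesqForm.re_inner_approx_le hQ n.cast_add_one_pos u))
    simp only [mul_add, Finset.mul_sum, mul_assoc, mul_left_comm _ (1 / 2 : ℝ)]
  exact ⟨fun u hu => (key ⟨u, hu⟩).1, fun u => (key u).2⟩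

end WeightedGraph

theorem mainTheorem2 {V : Type*} [Countable V] [MeasurableSpace V] [DiscreteMeasurableSpace V]
    (G : WeightedGraph V) (hG : G.LocallyFinite) :
    (∀ (L : G.ell2 →ₗ.[ℂ] G.ell2) (Q : SesqForm G.ell2),
      G.IsMarkovianRestriction L → Q.IsAssociatedTo L →
        G.neumannForm.FormLE Q ∧ Q.FormLE G.dirichletForm) ∧
    (∃ L : G.ell2 →ₗ.[ℂ] G.ell2,
      G.IsMarkovianRestriction L ∧ G.neumannForm.IsAssociatedTo L) ∧
    (∃ L : G.ell2 →ₗ.[ℂ] G.ell2,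
      G.IsMarkovianRestriction L ∧ G.dirichletForm.IsAssociatedTo L) := by
  refine ⟨fun L Q hL hQ => ?_, ?_, ?_⟩
  · obtain ⟨hsa, -, hres, Q', hQ', hD⟩ := hL
    obtain rfl := hQ.unique hQ'
    exact ⟨WeightedGraph.neumannForm_formLE hG hsa hres hQ hD,
      WeightedGraph.formLE_dirichletForm hG hsa hres hQ⟩
  · exact WeightedGraph.exists_isMarkovianRestriction hG WeightedGraph.neumannForm_isDirichletForm
      G.finSupp_le ⟨le_rfl, fun _ _ => rfl⟩
  · exact WeightedGraph.exists_isMarkovianRestriction hG WeightedGraph.dirichletForm_isDirichletForm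
      G.dirichletForm_isClosureOf.2.1.1
      ⟨G.neumannForm.formClosure_le G.neumannForm_isNonneg G.finSupp, fun _ _ => rfl⟩
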